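/- **Definitions.** A *simplicial operad* $\mathcal O$ is a symmetric operad in simplicial sets, with unit $1\in\mathcal O(1)$, structure maps $\gamma$ and right actions of the symmetric groups $\Sigma_n$ on $\mathcal O(n)$; $\mathcal O_p$ denotes the operad in sets of its $p$-simplices. A *pair* $(\mathcal O,\mathcal W)$ is a simplicial operad with a simplicial sub-monoid $\mathcal W\subset\mathcal O(1)$. A map of pairs $\varphi\colon(\mathcal O,\mathcal W)\to(\mathcal O',\mathcal W')$ is a map of simplicial operads $\varphi\colon\mathcal O\to\mathcal O'$ with $\varphi(\mathcal W)\subset\mathcal W'$. Let $\mathbb T(n)$ be the set of planar rooted trees obtained by grafting atomic pieces $O_m\colon 1\to m$ ($m\ge 0$; the root node is the source) and $W_1\colon 1\leftarrow 1$ (the root node is the target), with $n$ leaf nodes labeled bijectively by $1,\dots,n$; the trivial tree is allowed, and a piece $O_0$ has no leaf node. Let $O$ be an operad in sets and $W\subset O(1)$ a sub-monoid. A *tree hammock* of height $q$ and type $\tau\in\mathbb T(n)$ consists of $q+1$ parallel copies of $\tau$ (planes $0,\dots,q$) with a downward arrow between corresponding nodes of consecutive planes. Pieces $O_m$ are labeled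 by elements of $O(m)$, pieces $W_1$ and vertical arrows by elements of $W$; the vertical arrows at the root and at the labeled leaves are identities. All squares commute: $\gamma(\alpha_i;b_{1,i},\dots,b_{m,i})=\gamma(a_i;\alpha_{i+1})$ for a piece $O_m$ with label $\alpha_i$ in plane $i$ and vertical arrows $a_i$ at its root node and $b_{s,i}$ at its leaf nodes, and $\gamma(w_i;a_i)=\gamma(b_i;w_{i+1})$ for a piece $W_1$ with label $w_i$ in plane $i$ and vertical arrows $a_i$ at its root node and $b_i$ at its leaf node. Tree hammocks are considered up to changes of the planar structure: one may permute the branches at a piece $O_m$ by $\sigma\in\Sigma_m$ while acting with $\sigma$ on the labels of this piece in all planes. A tree hammock is *reduced* if adjacent pieces point in different directions and no column of pieces $O_1$ or $W_1$ is labeled by identities only. *Reduction* means composing columns of adjacent pieces pointing in the same direction, and deleting columns of identities; let two tree hammocks be equivalent if they are connected by reductions, inverse reductions and changes of the planar structure. The *tree hammock localization* $L^{TH}_{\mathcal W}\mathcal O$ is the operad in bisimplicial sets whose $(p,q)$-simplices of arity $n$ are the equivalence classes of tree hammocks of height $q$ and of types $\tau\in\mathbb T(n)$ for $(\mathcal O_p,\mathcal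 W_p)$. The $p$-direction uses the simplicial operators of $\mathcal O$; in the $q$-direction, planes are deleted (composing vertical arrows) or repeated. The symmetric groups relabel the labeled leaves, operadic composition is grafting, and the unit is the trivial tree. **Lemma (Functoriality).** 1. Every equivalence class of tree hammocks contains a reduced tree hammock, and it is unique up to changes of the planar structure. Hence the simplices of $L^{TH}_{\mathcal W}\mathcal O$ are the reduced tree hammocks, with all operations followed by reduction. 2. Every map of pairs $\varphi\colon(\mathcal O,\mathcal W)\to(\mathcal O',\mathcal W')$ induces a map of operads in bisimplicial sets $$L\varphi\colon L^{TH}_{\mathcal W}\mathcal O\longrightarrow L^{TH}_{\mathcal W'}\mathcal O',$$ namely the unique one which sends the class of each tree hammock to the class of the tree hammock obtained by applying $\varphi$ to all labels. Moreover $L(\mathrm{id})=\mathrm{id}$ and $L(\psi\circ\varphi)=L\psi\circ L\varphi$. 3. In particular there is a map of operads in bisimplicial sets $\eta\colon\mathcal O\to L^{TH}_{\mathcal W}\mathcal O$, natural in $(\mathcal O,\mathcal W)$, where $\mathcal O$ is regarded as constant in the second simplicial direction. It sends $\alpha\in\mathcal O_p(n)$ to the class of the corolla $O_n$ labeled by $\alpha$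 in all planes, with identities as vertical arrows. For $\mathcal W=\{1\}$ it is an isomorphism $\mathcal O\cong L^{TH}_{\{1\}}\mathcal O$, and in general it is the composite of this isomorphism with the map $L^{TH}_{\{1\}}\mathcal O\to L^{TH}_{\mathcal W}\mathcal O$ induced by $(\mathcal O,\{1\})\to(\mathcal O,\mathcal W)$. -/

import Mathlib

open CategoryTheory

universe u

/-! ### Symmetric operads in sets -/

/-- Transport of an operation along an equality of arities. -/
def castArity {Op : ℕ → Type u} {m n : ℕ} (h : m = n) (x : Op m) : Op n := h ▸ x

theorem sum_sum_finSigma {k : ℕ} (j : Fin k → ℕ) (i : Fin (∑ s, j s) → ℕ) :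
    ∑ z, i z = ∑ s, ∑ t, i (finSigmaFinEquiv ⟨s, t⟩) := by
  rw [← Equiv.sum_comp finSigmaFinEquiv i, Fintype.sum_sigma]

theorem sum_comp_perm {k : ℕ} (σ : Equiv.Perm (Fin k)) (j : Fin k → ℕ) :
    ∑ s, j (σ.symm s) = ∑ s, j s := Equiv.sum_comp σ.symm j

/-- The permutation `σ(j₁, …, jₖ)` permuting blocks of sizes `j₁, …, jₖ` according to `σ`:
the `y`-th element of block `s` is sent to the `y`-th element of the `σ s`-th block of the
reordered sequence of blocks. -/
def blockPerm {k : ℕ} (σ : Equiv.Perm (Fin k)) (j : Fin k → ℕ) :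
    Equiv.Perm (Fin (∑ s, j s)) :=
  ((finSigmaFinEquiv (n := j)).symm.trans (Equiv.sigmaCongrLeft' σ)).trans
    ((finSigmaFinEquiv (n := fun s => j (σ.symm s))).trans (finCongr (sum_comp_perm σ j)))

/-- The permutation `τ₁ ⊕ … ⊕ τₖ`. -/
def blockSum {k : ℕ} {j : Fin k → ℕ} (τ : ∀ s, Equiv.Perm (Fin (j s))) :
    Equiv.Perm (Fin (∑ s, j s)) :=
  (finSigmaFinEquiv.symm.trans (Equiv.sigmaCongrRight τ)).trans finSigmaFinEquiv

/-- A (symmetric) operad in sets: `act` is the right action of the symmetric groups, `comp` is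
the structure map `γ`. -/
structure SymmOperad where
  Op : ℕ → Type u
  one : Op 1
  act : ∀ {n : ℕ}, Op n → Equiv.Perm (Fin n) → Op n
  comp : ∀ {k : ℕ} {j : Fin k → ℕ}, Op k → (∀ s, Op (j s)) → Op (∑ s, j s)
  act_one : ∀ {n : ℕ} (x : Op n), act x 1 = x
  act_mul : ∀ {n : ℕ} (x : Op n) (σ τ : Equiv.Perm (Fin n)), act x (σ * τ) = act (act x σ) τ
  one_comp : ∀ {n : ℕ} (h : ∑ _s : Fin 1, n = n) (x : Op n),
    castArity h (comp (j := fun _ : Fin 1 => n) one (fun _ => x)) = x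
  comp_one : ∀ {k : ℕ} (h : ∑ _s : Fin k, 1 = k) (x : Op k),
    castArity h (comp (j := fun _ : Fin k => 1) x (fun _ => one)) = x
  assoc : ∀ {k : ℕ} {j : Fin k → ℕ} {i : Fin (∑ s, j s) → ℕ}
    (x : Op k) (y : ∀ s, Op (j s)) (z : ∀ r, Op (i r)),
    castArity (sum_sum_finSigma j i) (comp (comp x y) z) =
      comp x (fun s => comp (y s) (fun t => z (finSigmaFinEquiv ⟨s, t⟩)))
  act_comp : ∀ {k : ℕ} {j : Fin k → ℕ} (σ : Equiv.Perm (Fin k)) (x : Op k) (y : ∀ s, Op (j s)),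
    comp (act x σ) y =
      act (castArity (sum_comp_perm σ j) (comp x (fun s => y (σ.symm s)))) (blockPerm σ j)
  comp_act : ∀ {k : ℕ} {j : Fin k → ℕ} (τ : ∀ s, Equiv.Perm (Fin (j s))) (x : Op k)
    (y : ∀ s, Op (j s)),
    comp x (fun s => act (y s) (τ s)) = act (comp x y) (blockSum τ)

namespace SymmOperad

/-- A map of operads. -/
@[ext]
structure Hom (O P : SymmOperad.{u}) where
  app : ∀ {n : ℕ}, O.Op n → P.Op n
  map_one : app O.one = P.one
  map_act : ∀ {n : ℕ} (x : O.Op n) (σ : Equiv.Perm (Fin n)),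
    app (O.act x σ) = P.act (app x) σ
  map_comp : ∀ {k : ℕ} {j : Fin k → ℕ} (x : O.Op k) (y : ∀ s, O.Op (j s)),
    app (O.comp x y) = P.comp (app x) (fun s => app (y s))

instance : Category SymmOperad.{u} where
  Hom := Hom
  id O := { app := fun x => x, map_one := rfl, map_act := fun _ _ => rfl,
            map_comp := fun _ _ => rfl }
  comp f g :=
    { app := fun x => g.app (f.app x)
      map_one := by rw [f.map_one, g.map_one]
      map_act := fun x σ => by rw [f.map_act, g.map_act]
      map_comp := fun x y => by rw [f.map_comp, g.map_comp] }

theorem hom_ext {O P : SymmOperad.{u}} {f g : O ⟶ P}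
    (h : ∀ n (x : O.Op n), f.app x = g.app x) : f = g := by
  apply Hom.ext
  funext n x
  exact h n x

theorem Hom.map_castArity {O P : SymmOperad.{u}} (f : O ⟶ P) {m n : ℕ} (h : m = n)
    (x : O.Op m) : f.app (castArity h x) = castArity h (f.app x) := by
  subst h; rfl

variable (O : SymmOperad.{u})

/-- `γ(a; x)` for a one-ary operation `a`. -/
def unaryComp {n : ℕ} (a : O.Op 1) (x : O.Op n) : O.Op n :=
  castArity (by simp) (O.comp (j := fun _ : Fin 1 => n) a (fun _ => x))

/-- `γ(x; b₁, …, bₙ)` for one-ary operations `b₁, …, bₙ`. -/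
def compUnary {n : ℕ} (x : O.Op n) (b : Fin n → O.Op 1) : O.Op n :=
  castArity (by simp) (O.comp (j := fun _ : Fin n => 1) x b)


theorem castArity_castArity {Op : ℕ → Type u} {l m n : ℕ} (h : l = m) (h' : m = n) (x : Op l) :
    castArity h' (castArity h x) = castArity (h.trans h') x := by
  subst h; subst h'; rfl

theorem castArity_congr {Op : ℕ → Type u} {l m n : ℕ} (h : l = n) (h' : m = n) (e : l = m)
    {x : Op l} {y : Op m} (hxy : castArity e x = y) : castArity h x = castArity h' y := by
  subst e; subst hxy; rfl

theorem comp_castArity_left {k k' : ℕ} (h : k = k') {j : Fin k' → ℕ} (x : O.Op k)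
    (y : ∀ s, O.Op (j s)) :
    O.comp (castArity h x) y =
      castArity (by subst h; rfl) (O.comp x (fun s => y (Fin.cast h s))) := by
  subst h; rfl

theorem comp_castArity_right {k : ℕ} {j j' : Fin k → ℕ} (h : ∀ s, j s = j' s) (x : O.Op k)
    (y : ∀ s, O.Op (j s)) :
    O.comp x (fun s => castArity (h s) (y s)) =
      castArity (by simp [h]) (O.comp x y) := by
  obtain rfl : j = j' := funext h
  rfl

theorem finSigma_const_one {k : ℕ} (s : Fin k) (t : Fin 1) (h : ∑ _s : Fin k, 1 = k) :
    Fin.cast h (finSigmaFinEquiv (n := fun _ : Fin k => 1) ⟨s, t⟩) = s := by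
  ext; simp

theorem compUnary_compUnary {n : ℕ} (x : O.Op n) (b b' : Fin n → O.Op 1) :
    O.compUnary (O.compUnary x b) b' = O.compUnary x (fun s => O.compUnary (b s) (fun _ => b' s)) := by
  unfold compUnary
  rw [comp_castArity_left, castArity_castArity, comp_castArity_right, castArity_castArity]
  refine castArity_congr _ _ (sum_sum_finSigma (fun _ : Fin n => 1) (fun _ => 1)) ?_
  rw [O.assoc]
  congr 1
  funext s
  congr 1
  funext t
  rw [finSigma_const_one]

theorem compUnary_unaryComp {n : ℕ} (a : O.Op 1) (x : O.Op n) (b : Fin n → O.Op 1) :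
    O.compUnary (O.unaryComp a x) b = O.unaryComp a (O.compUnary x b) := by
  unfold compUnary unaryComp
  rw [comp_castArity_left, castArity_castArity, comp_castArity_right (O := O) (j := fun _ : Fin 1 => ∑ _s : Fin n, 1), castArity_castArity]
  refine castArity_congr _ _ (sum_sum_finSigma (fun _ : Fin 1 => n) (fun _ => 1)) ?_
  rw [O.assoc]
  congr 1
  funext s
  congr 1
  funext t
  congr 1
  ext
  simp

theorem unaryComp_unaryComp {n : ℕ} (a a' : O.Op 1) (x : O.Op n) :
    O.unaryComp (O.unaryComp a a') x = O.unaryComp a (O.unaryComp a' x) := by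
  unfold unaryComp
  rw [comp_castArity_left, castArity_castArity, comp_castArity_right (O := O) (j := fun _ : Fin 1 => ∑ _s : Fin 1, n), castArity_castArity]
  refine castArity_congr _ _ (sum_sum_finSigma (fun _ : Fin 1 => 1) (fun _ => n)) ?_
  rw [O.assoc]

theorem one_unaryComp {n : ℕ} (x : O.Op n) : O.unaryComp O.one x = x := O.one_comp _ x

theorem compUnary_one {n : ℕ} (x : O.Op n) : O.compUnary x (fun _ => O.one) = x :=
  O.comp_one _ x

/-- The monoid of one-ary operations, with product `γ(x; y)`. -/
instance : Monoid (O.Op 1) where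
  mul x y := O.unaryComp x y
  one := O.one
  mul_assoc := O.unaryComp_unaryComp
  one_mul := O.one_unaryComp
  mul_one := O.compUnary_one

theorem mul_def (x y : O.Op 1) : x * y = O.unaryComp x y := rfl

theorem one_def : (1 : O.Op 1) = O.one := rfl

variable {O}

theorem Hom.map_unaryComp {P : SymmOperad.{u}} (f : O ⟶ P) {n : ℕ} (a : O.Op 1) (x : O.Op n) :
    f.app (O.unaryComp a x) = P.unaryComp (f.app a) (f.app x) := by
  unfold unaryComp
  rw [Hom.map_castArity, Hom.map_comp]

theorem Hom.map_compUnary {P : SymmOperad.{u}} (f : O ⟶ P) {n : ℕ} (x : O.Op n)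
    (b : Fin n → O.Op 1) :
    f.app (O.compUnary x b) = P.compUnary (f.app x) (fun s => f.app (b s)) := by
  unfold compUnary
  rw [Hom.map_castArity, Hom.map_comp]

/-- The homomorphism between monoids of one-ary operations induced by a map of operads. -/
def Hom.unary {P : SymmOperad.{u}} (f : O ⟶ P) : O.Op 1 →* P.Op 1 where
  toFun x := f.app x
  map_one' := f.map_one
  map_mul' := f.map_unaryComp

end SymmOperad

/-! ### Vertical columns -/

/-- The composite `a_x · a_{x+1} ⋯ a_{y-1}` of the arrows of the column `a` which lead from
level `x` down to level `y`. -/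
def vertPath {M : Type u} [Monoid M] {k : ℕ} (a : Fin k → M) (x y : ℕ) : M :=
  ((List.range' x (y - x)).map (fun i => if h : i < k then a ⟨i, h⟩ else 1)).prod

/-- The column obtained from `a` by keeping only the levels `θ 0 ≤ θ 1 ≤ …` (with repetitions if
`θ` is not injective) and composing the arrows in between. -/
def reindexVert {M : Type u} [Monoid M] {k l : ℕ} (θ : Fin (l + 1) →o Fin (k + 1))
    (a : Fin k → M) : Fin l → M :=
  fun i => vertPath a (θ i.castSucc) (θ i.succ)

section Vert

variable {M N : Type u} [Monoid M] [Monoid N] {k l m : ℕ}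

theorem vertPath_self (a : Fin k → M) (x : ℕ) : vertPath a x x = 1 := by
  simp [vertPath]

theorem vertPath_succ (a : Fin k → M) (i : Fin k) : vertPath a i (i + 1) = a i := by
  simp [vertPath]

theorem vertPath_mul (a : Fin k → M) {x y z : ℕ} (h : x ≤ y) (h' : y ≤ z) :
    vertPath a x y * vertPath a y z = vertPath a x z := by
  unfold vertPath
  rw [← List.prod_append, ← List.map_append]
  obtain ⟨p, rfl⟩ := Nat.exists_eq_add_of_le h
  obtain ⟨q, rfl⟩ := Nat.exists_eq_add_of_le h'
  rw [Nat.add_sub_cancel_left, Nat.add_sub_cancel_left, List.range'_append_1,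
    Nat.add_assoc, Nat.add_sub_cancel_left]

theorem map_vertPath (f : M →* N) (a : Fin k → M) (x y : ℕ) :
    f (vertPath a x y) = vertPath (fun i => f (a i)) x y := by
  unfold vertPath
  rw [map_list_prod, List.map_map]
  congr 2
  funext i
  by_cases h : i < k <;> simp [h]

theorem vertPath_one (x y : ℕ) : vertPath (1 : Fin k → M) x y = 1 := by
  unfold vertPath
  apply List.prod_eq_one
  simp

theorem reindexVert_one (θ : Fin (l + 1) →o Fin (k + 1)) :
    reindexVert θ (1 : Fin k → M) = 1 := by
  funext i
  exact vertPath_one _ _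

theorem reindexVert_id (a : Fin k → M) : reindexVert OrderHom.id a = a := by
  funext i
  exact vertPath_succ a i

theorem vertPath_reindexVert (θ : Fin (l + 1) →o Fin (k + 1)) (a : Fin k → M) (x : ℕ)
    (hx : x < l + 1) (y : ℕ) (hxy : x ≤ y) (hy : y < l + 1) :
    vertPath (reindexVert θ a) x y = vertPath a (θ ⟨x, hx⟩) (θ ⟨y, hy⟩) := by
  induction y, hxy using Nat.le_induction with
  | base => rw [vertPath_self, vertPath_self]
  | succ y hxy ih =>
    have e := vertPath_succ (reindexVert θ a) ⟨y, by omega⟩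
    rw [← vertPath_mul _ hxy (Nat.le_succ y), ih (by omega)]
    refine (congrArg _ e).trans ?_
    exact vertPath_mul a (θ.monotone (by simpa using hxy)) (θ.monotone (by simp))

theorem reindexVert_reindexVert (η : Fin (m + 1) →o Fin (l + 1)) (θ : Fin (l + 1) →o Fin (k + 1))
    (a : Fin k → M) : reindexVert η (reindexVert θ a) = reindexVert (θ.comp η) a := by
  funext i
  exact vertPath_reindexVert θ a _ (η i.castSucc).2 _ (η.monotone (by simp [Fin.le_def]))
    (η i.succ).2

end Vert

/-! ### Tree hammocks -/

/-- A column of operations `α₀, …, αₖ` of arity `m` fits between the vertical column `a` at its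
root node and the vertical columns `b₁, …, bₘ` at its leaf nodes if each of the `k` squares
`γ(αᵢ; bᵢ₁, …, bᵢₘ) = γ(aᵢ; αᵢ₊₁)` commutes. -/
def OpSquares {O : SymmOperad.{u}} {W : Submonoid (O.Op 1)} {k m : ℕ} (a : Fin k → W)
    (α : Fin (k + 1) → O.Op m) (b : Fin m → Fin k → W) : Prop :=
  ∀ i : Fin k, O.compUnary (α i.castSucc) (fun s => (b s i : O.Op 1)) =
    O.unaryComp (a i : O.Op 1) (α i.succ)

/-- A column of left pointing arrows `w₀, …, wₖ` fits between the vertical column `a` at its root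
node and the vertical column `b` at its leaf node if the `k` squares
`γ(wᵢ; aᵢ) = γ(bᵢ; wᵢ₊₁)` commute. -/
def InvSquares {O : SymmOperad.{u}} {W : Submonoid (O.Op 1)} {k : ℕ} (a : Fin k → W)
    (w : Fin (k + 1) → W) (b : Fin k → W) : Prop :=
  ∀ i : Fin k, w i.castSucc * a i = b i * w i.succ

/-- Tree hammocks (not necessarily reduced) of height `k`, that is with planes `0, …, k`, with
leaves labeled by elements of `X` and with prescribed column of vertical arrows at the root:

* `leaf` is the trivial tree, its only node is a labeled leaf; the vertical arrows at labeled
  leaves are identities;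
* `op` has as root piece an atomic piece `1 → m` with column of labels `α`, on whose `m` leaf nodes
  tree hammocks are grafted; for `m = 0` this is an unlabeled leaf;
* `inv` has as root piece an atomic piece `1 ← 1` with column of labels `w` in `W`. -/
inductive Hammock (O : SymmOperad.{u}) (W : Submonoid (O.Op 1)) (k : ℕ) (X : Type) :
    (Fin k → W) → Type u
  | leaf (a : Fin k → W) (ha : a = 1) (x : X) : Hammock O W k X a
  | op (a : Fin k → W) (m : ℕ) (α : Fin (k + 1) → O.Op m) (b : Fin m → Fin k → W)
      (sq : OpSquares a α b) (c : ∀ s, Hammock O W k X (b s)) : Hammock O W k X a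
  | inv (a b : Fin k → W) (w : Fin (k + 1) → W) (sq : InvSquares a w b)
      (c : Hammock O W k X b) : Hammock O W k X a

namespace Hammock

section

variable {O : SymmOperad.{u}} {W : Submonoid (O.Op 1)} {k : ℕ} {X Y Z : Type}

/-- The root piece is `1 → m`. -/
def RootIsOp : ∀ {a : Fin k → W}, Hammock O W k X a → Prop
  | _, leaf _ _ _ => False
  | _, op _ _ _ _ _ _ => True
  | _, inv _ _ _ _ _ => False

/-- The root piece is `1 ← 1`. -/
def RootIsInv : ∀ {a : Fin k → W}, Hammock O W k X a → Prop
  | _, leaf _ _ _ => False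
  | _, op _ _ _ _ _ _ => False
  | _, inv _ _ _ _ _ => True

/-- A tree hammock is reduced if adjacent columns of pieces point in different directions and no
column of pieces `1 → 1` or `1 ← 1` consists of identities only. -/
def Reduced : ∀ {a : Fin k → W}, Hammock O W k X a → Prop
  | _, leaf _ _ _ => True
  | _, op _ m α _ _ c =>
      (∀ s, ¬ (c s).RootIsOp) ∧ (¬ ∃ h : m = 1, ∀ i, castArity h (α i) = O.one) ∧
        ∀ s, (c s).Reduced
  | _, inv _ _ w _ c => ¬ c.RootIsInv ∧ (¬ ∀ i, w i = 1) ∧ c.Reduced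

/-- The multiset of labels of the labeled leaves. -/
def labels : ∀ {a : Fin k → W}, Hammock O W k X a → Multiset X
  | _, leaf _ _ x => {x}
  | _, op _ _ _ _ _ c => ∑ s, (c s).labels
  | _, inv _ _ _ _ c => c.labels

/-- Two tree hammocks are related by `PlanarIso` if they differ by changes of the planar structure:
the leaf nodes of a piece `1 → m` are permuted, and the symmetric group acts accordingly on the
labels of this piece. -/
inductive PlanarIso : ∀ {a : Fin k → W}, Hammock O W k X a → Hammock O W k X a → Prop
  | refl {a} (t : Hammock O W k X a) : PlanarIso t t
  | symm {a} {t t' : Hammock O W k X a} : PlanarIso t t' → PlanarIso t' t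
  | trans {a} {t t' t'' : Hammock O W k X a} : PlanarIso t t' → PlanarIso t' t'' → PlanarIso t t''
  | congrOp (a : Fin k → W) (m : ℕ) (α : Fin (k + 1) → O.Op m) (b : Fin m → Fin k → W)
      (sq : OpSquares a α b) (c c' : ∀ s, Hammock O W k X (b s)) :
      (∀ s, PlanarIso (c s) (c' s)) → PlanarIso (op a m α b sq c) (op a m α b sq c')
  | congrInv (a b : Fin k → W) (w : Fin (k + 1) → W) (sq : InvSquares a w b)
      (c c' : Hammock O W k X b) :
      PlanarIso c c' → PlanarIso (inv a b w sq c) (inv a b w sq c')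
  | permute (a : Fin k → W) (m : ℕ) (α : Fin (k + 1) → O.Op m) (b : Fin m → Fin k → W)
      (sq : OpSquares a α b) (c : ∀ s, Hammock O W k X (b s)) (σ : Equiv.Perm (Fin m))
      (sq' : OpSquares a (fun i => O.act (α i) σ) (fun s => b (σ s))) :
      PlanarIso (op a m α b sq c)
        (op a m (fun i => O.act (α i) σ) (fun s => b (σ s)) sq' (fun s => c (σ s)))

/-- The equivalence relation on tree hammocks generated by changes of the planar structure
(`permute`), by composing adjacent columns which point in the same direction (`composeOp`,
`composeInv`), and by deleting columns of identities (`deleteOp`, `deleteInv`). All moves can be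
applied at any place of the tree (`congrOp`, `congrInv`). Composition of a single adjacent pair of
pieces is covered by `composeOp`, as identity columns can be inserted at the other leaf nodes. -/
inductive Equivalent : ∀ {a : Fin k → W}, Hammock O W k X a → Hammock O W k X a → Prop
  | refl {a} (t : Hammock O W k X a) : Equivalent t t
  | symm {a} {t t' : Hammock O W k X a} : Equivalent t t' → Equivalent t' t
  | trans {a} {t t' t'' : Hammock O W k X a} :
      Equivalent t t' → Equivalent t' t'' → Equivalent t t''
  | congrOp (a : Fin k → W) (m : ℕ) (α : Fin (k + 1) → O.Op m) (b : Fin m → Fin k → W)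
      (sq : OpSquares a α b) (c c' : ∀ s, Hammock O W k X (b s)) :
      (∀ s, Equivalent (c s) (c' s)) → Equivalent (op a m α b sq c) (op a m α b sq c')
  | congrInv (a b : Fin k → W) (w : Fin (k + 1) → W) (sq : InvSquares a w b)
      (c c' : Hammock O W k X b) :
      Equivalent c c' → Equivalent (inv a b w sq c) (inv a b w sq c')
  | permute (a : Fin k → W) (m : ℕ) (α : Fin (k + 1) → O.Op m) (b : Fin m → Fin k → W)
      (sq : OpSquares a α b) (c : ∀ s, Hammock O W k X (b s)) (σ : Equiv.Perm (Fin m))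
      (sq' : OpSquares a (fun i => O.act (α i) σ) (fun s => b (σ s))) :
      Equivalent (op a m α b sq c)
        (op a m (fun i => O.act (α i) σ) (fun s => b (σ s)) sq' (fun s => c (σ s)))
  | composeOp (a : Fin k → W) (m : ℕ) (α : Fin (k + 1) → O.Op m) (b : Fin m → Fin k → W)
      (sq : OpSquares a α b) (j : Fin m → ℕ) (β : ∀ s, Fin (k + 1) → O.Op (j s))
      (d : ∀ s, Fin (j s) → Fin k → W) (sq' : ∀ s, OpSquares (b s) (β s) (d s))
      (c : ∀ s t, Hammock O W k X (d s t))
      (sq'' : OpSquares a (fun i => O.comp (α i) (fun s => β s i))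
        (fun z => d (finSigmaFinEquiv.symm z).1 (finSigmaFinEquiv.symm z).2)) :
      Equivalent (op a m α b sq (fun s => op (b s) (j s) (β s) (d s) (sq' s) (c s)))
        (op a (∑ s, j s) (fun i => O.comp (α i) (fun s => β s i))
          (fun z => d (finSigmaFinEquiv.symm z).1 (finSigmaFinEquiv.symm z).2) sq''
          (fun z => c (finSigmaFinEquiv.symm z).1 (finSigmaFinEquiv.symm z).2))
  | composeInv (a b b' : Fin k → W) (w w' : Fin (k + 1) → W) (sq : InvSquares a w b)
      (sq' : InvSquares b w' b') (c : Hammock O W k X b')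
      (sq'' : InvSquares a (fun i => w' i * w i) b') :
      Equivalent (inv a b w sq (inv b b' w' sq' c)) (inv a b' (fun i => w' i * w i) sq'' c)
  | deleteOp (a : Fin k → W) (sq : OpSquares a (fun _ => O.one) (fun _ : Fin 1 => a))
      (c : Hammock O W k X a) :
      Equivalent (op a 1 (fun _ => O.one) (fun _ => a) sq (fun _ => c)) c
  | deleteInv (a : Fin k → W) (sq : InvSquares a (fun _ => 1) a) (c : Hammock O W k X a) :
      Equivalent (inv a a (fun _ => 1) sq c) c

/-- Relabeling of the labeled leaves. -/
def relabel (f : X → Y) : ∀ {a : Fin k → W}, Hammock O W k X a → Hammock O W k Y a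
  | _, leaf a ha x => leaf a ha (f x)
  | _, op a m α b sq c => op a m α b sq (fun s => (c s).relabel f)
  | _, inv a b w sq c => inv a b w sq (c.relabel f)

/-- Grafting the tree hammock `f x` on each labeled leaf with label `x`. -/
def graft (f : X → Hammock O W k Y 1) : ∀ {a : Fin k → W}, Hammock O W k X a → Hammock O W k Y a
  | _, leaf _ ha x => ha ▸ f x
  | _, op a m α b sq c => op a m α b sq (fun s => (c s).graft f)
  | _, inv a b w sq c => inv a b w sq (c.graft f)

end


/-- The homomorphism of sub-monoids induced by a map of operads. -/
def restrictUnary {O P : SymmOperad.{u}} {W : Submonoid (O.Op 1)} {V : Submonoid (P.Op 1)}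
    (φ : O ⟶ P) (hφ : ∀ w ∈ W, φ.app w ∈ V) : W →* V where
  toFun w := ⟨φ.app w.1, hφ _ w.2⟩
  map_one' := Subtype.ext φ.map_one
  map_mul' _ _ := Subtype.ext (φ.map_unaryComp _ _)

section

variable {O P Q : SymmOperad.{u}} {W : Submonoid (O.Op 1)} {V : Submonoid (P.Op 1)}
  {U : Submonoid (Q.Op 1)} {k l p : ℕ} {X Y Z : Type}

theorem _root_.OpSquares.map (φ : O ⟶ P) (hφ : ∀ w ∈ W, φ.app w ∈ V) {m : ℕ} {a : Fin k → W}
    {α : Fin (k + 1) → O.Op m} {b : Fin m → Fin k → W} (sq : OpSquares a α b) {a' : Fin k → V}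
    (ha : a' = fun i => restrictUnary φ hφ (a i)) :
    OpSquares a' (fun i => φ.app (α i)) (fun s i => restrictUnary φ hφ (b s i)) := by
  subst ha
  intro i
  have := congrArg φ.app (sq i)
  rwa [φ.map_compUnary, φ.map_unaryComp] at this

theorem _root_.InvSquares.map (φ : O ⟶ P) (hφ : ∀ w ∈ W, φ.app w ∈ V) {a b : Fin k → W}
    {w : Fin (k + 1) → W} (sq : InvSquares a w b) {a' : Fin k → V}
    (ha : a' = fun i => restrictUnary φ hφ (a i)) :
    InvSquares a' (fun i => restrictUnary φ hφ (w i)) (fun i => restrictUnary φ hφ (b i)) := by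
  subst ha
  intro i
  rw [← map_mul, sq i, map_mul]

theorem _root_.OpSquares.reindex (θ : Fin (l + 1) →o Fin (k + 1)) {m : ℕ} {a : Fin k → W}
    {α : Fin (k + 1) → O.Op m} {b : Fin m → Fin k → W} (sq : OpSquares a α b) {a' : Fin l → W}
    (ha : a' = reindexVert θ a) :
    OpSquares a' (fun i => α (θ i)) (fun s => reindexVert θ (b s)) := by
  subst ha
  have key : ∀ (x : ℕ) (hx : x < k + 1) (y : ℕ), x ≤ y → ∀ hy : y < k + 1,
      O.compUnary (α ⟨x, hx⟩) (fun s => ((vertPath (b s) x y : W) : O.Op 1)) =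
        O.unaryComp ((vertPath a x y : W) : O.Op 1) (α ⟨y, hy⟩) := by
    intro x hx y hxy
    induction y, hxy using Nat.le_induction with
    | base =>
      intro hy
      simp only [vertPath_self, OneMemClass.coe_one, O.one_def]
      rw [O.compUnary_one, O.one_unaryComp]
    | succ y hxy ih =>
      intro hy
      have hyk : y < k := by omega
      have e : ∀ c : Fin k → W, vertPath c x (y + 1) = vertPath c x y * c ⟨y, hyk⟩ := by
        intro c
        rw [← vertPath_mul _ hxy (Nat.le_succ y)]
        exact congrArg _ (vertPath_succ c ⟨y, hyk⟩)
      simp only [e, Submonoid.coe_mul, O.mul_def]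
      have h1 := O.compUnary_compUnary (α ⟨x, hx⟩) (fun s => ((vertPath (b s) x y : W) : O.Op 1))
        (fun s => (b s ⟨y, hyk⟩ : O.Op 1))
      refine h1.symm.trans ?_
      rw [ih (by omega), O.compUnary_unaryComp, O.unaryComp_unaryComp]
      exact congrArg _ (sq ⟨y, hyk⟩)
  intro i
  exact key _ _ _ (θ.monotone (by simp [Fin.le_def])) _

theorem _root_.InvSquares.reindex (θ : Fin (l + 1) →o Fin (k + 1)) {a b : Fin k → W}
    {w : Fin (k + 1) → W} (sq : InvSquares a w b) {a' : Fin l → W}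
    (ha : a' = reindexVert θ a) :
    InvSquares a' (fun i => w (θ i)) (reindexVert θ b) := by
  subst ha
  have key : ∀ (x : ℕ) (hx : x < k + 1) (y : ℕ), x ≤ y → ∀ hy : y < k + 1,
      w ⟨x, hx⟩ * vertPath a x y = vertPath b x y * w ⟨y, hy⟩ := by
    intro x hx y hxy
    induction y, hxy using Nat.le_induction with
    | base =>
      intro hy
      rw [vertPath_self, vertPath_self, mul_one, one_mul]
    | succ y hxy ih =>
      intro hy
      have hyk : y < k := by omega
      have e : ∀ c : Fin k → W, vertPath c x (y + 1) = vertPath c x y * c ⟨y, hyk⟩ := by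
        intro c
        rw [← vertPath_mul _ hxy (Nat.le_succ y)]
        exact congrArg _ (vertPath_succ c ⟨y, hyk⟩)
      rw [e, e, ← mul_assoc, ih (by omega), mul_assoc, mul_assoc]
      exact congrArg _ (sq ⟨y, hyk⟩)
  intro i
  exact key _ _ _ (θ.monotone (by simp [Fin.le_def])) _

/-- Application of a map of operads to all labels of a tree hammock. -/
def map (φ : O ⟶ P) (hφ : ∀ w ∈ W, φ.app w ∈ V) : ∀ {a : Fin k → W}, Hammock O W k X a →
    ∀ a' : Fin k → V, a' = (fun i => restrictUnary φ hφ (a i)) → Hammock P V k X a'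
  | _, leaf a h x, a', h' => leaf a' (by subst h; rw [h']; funext i; exact map_one _) x
  | _, op a m α b sq c, a', h' =>
      op a' m (fun i => φ.app (α i)) (fun s i => restrictUnary φ hφ (b s i)) (sq.map φ hφ h')
        (fun s => (c s).map φ hφ _ rfl)
  | _, inv a b w sq c, a', h' =>
      inv a' (fun i => restrictUnary φ hφ (b i)) (fun i => restrictUnary φ hφ (w i))
        (sq.map φ hφ h') (c.map φ hφ _ rfl)

/-- The simplicial operators: planes are deleted or repeated as prescribed by `θ`, and adjacent
vertical arrows are composed. -/
def reindex (θ : Fin (l + 1) →o Fin (k + 1)) : ∀ {a : Fin k → W}, Hammock O W k X a →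
    ∀ a' : Fin l → W, a' = reindexVert θ a → Hammock O W l X a'
  | _, leaf a h x, a', h' => leaf a' (by subst h; rw [h']; exact reindexVert_one θ) x
  | _, op a m α b sq c, a', h' =>
      op a' m (fun i => α (θ i)) (fun s => reindexVert θ (b s)) (sq.reindex θ h')
        (fun s => (c s).reindex θ _ rfl)
  | _, inv a b w sq c, a', h' =>
      inv a' (reindexVert θ b) (fun i => w (θ i)) (sq.reindex θ h') (c.reindex θ _ rfl)

/-! Compatibility of these operations with each other. -/

theorem op_congr {a : Fin k → W} {m : ℕ} {α α' : Fin (k + 1) → O.Op m} {b b' : Fin m → Fin k → W}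
    {sq : OpSquares a α b} {sq' : OpSquares a α' b'} {c : ∀ s, Hammock O W k X (b s)}
    {c' : ∀ s, Hammock O W k X (b' s)} (hα : α = α') (hb : b = b')
    (hc : ∀ s, c s ≍ c' s) : op a m α b sq c = op a m α' b' sq' c' := by
  subst hα; subst hb
  congr
  funext s
  exact eq_of_heq (hc s)

theorem inv_congr {a b b' : Fin k → W} {w w' : Fin (k + 1) → W} {sq : InvSquares a w b}
    {sq' : InvSquares a w' b'} {c : Hammock O W k X b} {c' : Hammock O W k X b'}
    (hw : w = w') (hb : b = b') (hc : c ≍ c') : inv a b w sq c = inv a b' w' sq' c' := by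
  subst hw; subst hb
  congr
  exact eq_of_heq hc

theorem relabel_relabel (f : X → Y) (g : Y → Z) {a : Fin k → W} (t : Hammock O W k X a) :
    (t.relabel f).relabel g = t.relabel (g ∘ f) := by
  induction t with
  | leaf a ha x => rfl
  | op a m α b sq c ih => simp only [relabel, ih]
  | inv a b w sq c ih => simp only [relabel, ih]

theorem relabel_id {a : Fin k → W} (t : Hammock O W k X a) : t.relabel id = t := by
  induction t with
  | leaf a ha x => rfl
  | op a m α b sq c ih => simp only [relabel, ih]
  | inv a b w sq c ih => simp only [relabel, ih]

theorem graft_leaf {a : Fin k → W} (f : X → Y) (t : Hammock O W k X a) :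
    t.graft (fun x => leaf 1 rfl (f x)) = t.relabel f := by
  induction t with
  | leaf a ha x => subst ha; rfl
  | op a m α b sq c ih => simp only [relabel, graft, ih]
  | inv a b w sq c ih => simp only [relabel, graft, ih]

theorem graft_relabel {a : Fin k → W} (f : X → Y) (g : Y → Hammock O W k Z 1)
    (t : Hammock O W k X a) : (t.relabel f).graft g = t.graft (fun x => g (f x)) := by
  induction t with
  | leaf a ha x => rfl
  | op a m α b sq c ih => simp only [relabel, graft, ih]
  | inv a b w sq c ih => simp only [relabel, graft, ih]

theorem relabel_graft {a : Fin k → W} (f : X → Hammock O W k Y 1) (g : Y → Z)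
    (t : Hammock O W k X a) : (t.graft f).relabel g = t.graft (fun x => (f x).relabel g) := by
  induction t with
  | leaf a ha x => subst ha; rfl
  | op a m α b sq c ih => simp only [relabel, graft, ih]
  | inv a b w sq c ih => simp only [relabel, graft, ih]

theorem graft_graft {a : Fin k → W} (f : X → Hammock O W k Y 1) (g : Y → Hammock O W k Z 1)
    (t : Hammock O W k X a) : (t.graft f).graft g = t.graft (fun x => (f x).graft g) := by
  induction t with
  | leaf a ha x => subst ha; rfl
  | op a m α b sq c ih => simp only [graft, ih]
  | inv a b w sq c ih => simp only [graft, ih]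

theorem labels_relabel {a : Fin k → W} (f : X → Y) (t : Hammock O W k X a) :
    (t.relabel f).labels = t.labels.map f := by
  induction t with
  | leaf a ha x => rfl
  | op a m α b sq c ih =>
    simp only [relabel, labels, ih]
    exact (map_sum (Multiset.mapAddMonoidHom f) _ _).symm
  | inv a b w sq c ih => simp only [relabel, labels, ih]

theorem labels_graft {a : Fin k → W} (f : X → Hammock O W k Y 1) (t : Hammock O W k X a) :
    (t.graft f).labels = t.labels.bind (fun x => (f x).labels) := by
  induction t with
  | leaf a ha x => subst ha; simp [graft, labels]
  | op a m α b sq c ih =>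
    simp only [graft, labels, ih]
    induction (Finset.univ : Finset (Fin m)) using Finset.induction_on with
    | empty => rfl
    | insert s S hs ih => rw [Finset.sum_insert hs, Finset.sum_insert hs, ih, Multiset.add_bind]
  | inv a b w sq c ih => simp only [graft, labels, ih]

theorem labels_map (φ : O ⟶ P) (hφ : ∀ w ∈ W, φ.app w ∈ V) {a : Fin k → W}
    (t : Hammock O W k X a) : ∀ a' h', (t.map φ hφ a' h').labels = t.labels := by
  induction t with
  | leaf a ha x => intro a' h'; rfl
  | op a m α b sq c ih => intro a' h'; simp only [map, labels, ih]
  | inv a b w sq c ih => intro a' h'; simp only [map, labels, ih]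

theorem labels_reindex (θ : Fin (l + 1) →o Fin (k + 1)) {a : Fin k → W}
    (t : Hammock O W k X a) : ∀ a' h', (t.reindex θ a' h').labels = t.labels := by
  induction t with
  | leaf a ha x => intro a' h'; rfl
  | op a m α b sq c ih => intro a' h'; simp only [reindex, labels, ih]
  | inv a b w sq c ih => intro a' h'; simp only [reindex, labels, ih]

theorem map_relabel (φ : O ⟶ P) (hφ : ∀ w ∈ W, φ.app w ∈ V) (f : X → Y) {a : Fin k → W}
    (t : Hammock O W k X a) :
    ∀ a' h', (t.relabel f).map φ hφ a' h' = (t.map φ hφ a' h').relabel f := by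
  induction t with
  | leaf a ha x => intro a' h'; rfl
  | op a m α b sq c ih => intro a' h'; simp only [map, relabel, ih]
  | inv a b w sq c ih => intro a' h'; simp only [map, relabel, ih]

theorem reindex_relabel (θ : Fin (l + 1) →o Fin (k + 1)) (f : X → Y) {a : Fin k → W}
    (t : Hammock O W k X a) :
    ∀ a' h', (t.relabel f).reindex θ a' h' = (t.reindex θ a' h').relabel f := by
  induction t with
  | leaf a ha x => intro a' h'; rfl
  | op a m α b sq c ih => intro a' h'; simp only [reindex, relabel, ih]
  | inv a b w sq c ih => intro a' h'; simp only [reindex, relabel, ih]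

theorem one_eq_map_one (φ : O ⟶ P) (hφ : ∀ w ∈ W, φ.app w ∈ V) :
    (1 : Fin k → V) = fun i => restrictUnary φ hφ ((1 : Fin k → W) i) := by
  funext i; exact (map_one _).symm

theorem map_graft (φ : O ⟶ P) (hφ : ∀ w ∈ W, φ.app w ∈ V) (f : X → Hammock O W k Y 1)
    {a : Fin k → W} (t : Hammock O W k X a) :
    ∀ a' h', (t.graft f).map φ hφ a' h' =
      (t.map φ hφ a' h').graft (fun x => (f x).map φ hφ 1 (one_eq_map_one φ hφ)) := by
  induction t with
  | leaf a ha x =>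
    intro a' h'
    subst ha
    obtain rfl : a' = 1 := h'.trans (one_eq_map_one φ hφ).symm
    rfl
  | op a m α b sq c ih => intro a' h'; simp only [map, graft, ih]
  | inv a b w sq c ih => intro a' h'; simp only [map, graft, ih]

theorem reindex_graft (θ : Fin (l + 1) →o Fin (k + 1)) (f : X → Hammock O W k Y 1)
    {a : Fin k → W} (t : Hammock O W k X a) :
    ∀ a' h', (t.graft f).reindex θ a' h' =
      (t.reindex θ a' h').graft (fun x => (f x).reindex θ 1 (reindexVert_one θ).symm) := by
  induction t with
  | leaf a ha x =>
    intro a' h'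
    subst ha
    obtain rfl : a' = 1 := h'.trans (reindexVert_one θ)
    rfl
  | op a m α b sq c ih => intro a' h'; simp only [reindex, graft, ih]
  | inv a b w sq c ih => intro a' h'; simp only [reindex, graft, ih]

theorem map_id {a : Fin k → W} (t : Hammock O W k X a) :
    ∀ a' h' (h : a' = a), t.map (𝟙 O) (V := W) (fun _ hw => hw) a' h' = h ▸ t := by
  induction t with
  | leaf a ha x => intro a' h' h; subst h; rfl
  | op a m α b sq c ih =>
    intro a' h' h; subst h
    exact op_congr rfl rfl (fun s => heq_of_eq (ih s _ _ rfl))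
  | inv a b w sq c ih =>
    intro a' h' h; subst h
    exact inv_congr rfl rfl (heq_of_eq (ih _ _ rfl))

theorem map_map (φ : O ⟶ P) (hφ : ∀ w ∈ W, φ.app w ∈ V) (ψ : P ⟶ Q)
    (hψ : ∀ v ∈ V, ψ.app v ∈ U) {a : Fin k → W} (t : Hammock O W k X a) :
    ∀ a' h' a'' h'' h, (t.map φ hφ a' h').map ψ hψ a'' h'' =
      t.map (φ ≫ ψ) (fun w hw => hψ _ (hφ w hw)) a'' h := by
  induction t with
  | leaf a ha x => intros; rfl
  | op a m α b sq c ih =>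
    intro a' h' a'' h'' h
    exact op_congr rfl rfl (fun s => heq_of_eq (ih s _ _ _ _ rfl))
  | inv a b w sq c ih =>
    intro a' h' a'' h'' h
    exact inv_congr rfl rfl (heq_of_eq (ih _ _ _ _ rfl))

theorem map_heq (φ : O ⟶ P) (hφ : ∀ w ∈ W, φ.app w ∈ V) {a : Fin k → W} (t : Hammock O W k X a)
    (a' a'' : Fin k → V) (h' h'') : t.map φ hφ a' h' ≍ t.map φ hφ a'' h'' := by
  subst h'; subst h''; rfl

theorem reindex_heq (θ : Fin (l + 1) →o Fin (k + 1)) {a : Fin k → W} (t : Hammock O W k X a)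
    (a' a'' : Fin l → W) (h' h'') : t.reindex θ a' h' ≍ t.reindex θ a'' h'' := by
  subst h'; subst h''; rfl

theorem reindex_id {a : Fin k → W} (t : Hammock O W k X a) :
    ∀ a' h', t.reindex OrderHom.id a' h' ≍ t := by
  induction t with
  | leaf a ha x => intro a' h'; obtain rfl : a' = a := h'.trans (reindexVert_id a); rfl
  | op a m α b sq c ih =>
    intro a' h'; obtain rfl : a' = a := h'.trans (reindexVert_id a)
    exact heq_of_eq (op_congr rfl (funext fun s => reindexVert_id (b s)) (fun s => ih s _ _))
  | inv a b w sq c ih =>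
    intro a' h'; obtain rfl : a' = a := h'.trans (reindexVert_id a)
    exact heq_of_eq (inv_congr rfl (reindexVert_id b) (ih _ _))

theorem reindex_reindex (η : Fin (p + 1) →o Fin (l + 1)) (θ : Fin (l + 1) →o Fin (k + 1))
    {a : Fin k → W} (t : Hammock O W k X a) :
    ∀ a' h' a'' h'' h, (t.reindex θ a' h').reindex η a'' h'' =
      t.reindex (θ.comp η) a'' h := by
  induction t with
  | leaf a ha x => intros; rfl
  | op a m α b sq c ih =>
    intro a' h' a'' h'' h
    refine op_congr rfl (funext fun s => reindexVert_reindexVert η θ (b s)) (fun s => ?_)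
    exact (heq_of_eq (ih s _ _ _ _ (reindexVert_reindexVert η θ (b s)))).trans
      (reindex_heq _ _ _ _ _ _)
  | inv a b w sq c ih =>
    intro a' h' a'' h'' h
    refine inv_congr rfl (reindexVert_reindexVert η θ b) ?_
    exact (heq_of_eq (ih _ _ _ _ (reindexVert_reindexVert η θ b))).trans
      (reindex_heq _ _ _ _ _ _)

theorem restrict_reindexVert (φ : O ⟶ P) (hφ : ∀ w ∈ W, φ.app w ∈ V)
    (θ : Fin (l + 1) →o Fin (k + 1)) (a : Fin k → W) :
    (fun i => restrictUnary φ hφ (reindexVert θ a i)) =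
      reindexVert θ (fun i => restrictUnary φ hφ (a i)) := by
  funext i
  exact map_vertPath _ _ _ _

theorem map_reindex (φ : O ⟶ P) (hφ : ∀ w ∈ W, φ.app w ∈ V) (θ : Fin (l + 1) →o Fin (k + 1))
    {a : Fin k → W} (t : Hammock O W k X a) :
    ∀ a' h' a'' h'' b' g' g'', (t.reindex θ a' h').map φ hφ a'' h'' =
      (t.map φ hφ b' g').reindex θ a'' g'' := by
  induction t with
  | leaf a ha x => intros; rfl
  | op a m α b sq c ih =>
    intro a' h' a'' h'' b' g' g''
    refine op_congr rfl (funext fun s => restrict_reindexVert φ hφ θ (b s)) (fun s => ?_)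
    exact (heq_of_eq (ih s _ rfl _ rfl _ rfl (restrict_reindexVert φ hφ θ (b s)))).trans
      (reindex_heq _ _ _ _ _ _)
  | inv a b w sq c ih =>
    intro a' h' a'' h'' b' g' g''
    refine inv_congr rfl (restrict_reindexVert φ hφ θ b) ?_
    exact (heq_of_eq (ih _ rfl _ rfl _ rfl (restrict_reindexVert φ hφ θ b))).trans
      (reindex_heq _ _ _ _ _ _)

/-! Compatibility of these operations with the equivalence relation. -/

theorem Equivalent.of_eq {a : Fin k → W} {t t' : Hammock O W k X a} (h : t = t') :
    Equivalent t t' := h ▸ Equivalent.refl t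

theorem Equivalent.relabel (f : X → Y) {a : Fin k → W} {t t' : Hammock O W k X a}
    (h : Equivalent t t') : Equivalent (t.relabel f) (t'.relabel f) := by
  induction h with
  | refl t => exact .refl _
  | symm _ ih => exact ih.symm
  | trans _ _ ih ih' => exact ih.trans ih'
  | congrOp a m α b sq c c' _ ih => exact .congrOp _ _ _ _ _ _ _ ih
  | congrInv a b w sq c c' _ ih => exact .congrInv _ _ _ _ _ _ ih
  | permute a m α b sq c σ sq' => exact .permute a m α b sq (fun s => (c s).relabel f) σ sq'
  | composeOp a m α b sq j β d sq' c sq'' =>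
    exact .composeOp a m α b sq j β d sq' (fun s r => (c s r).relabel f) sq''
  | composeInv a b b' w w' sq sq' c sq'' =>
    exact .composeInv a b b' w w' sq sq' (c.relabel f) sq''
  | deleteOp a sq c => exact .deleteOp a sq (c.relabel f)
  | deleteInv a sq c => exact .deleteInv a sq (c.relabel f)

theorem Equivalent.graft_left (f : X → Hammock O W k Y 1) {a : Fin k → W}
    {t t' : Hammock O W k X a} (h : Equivalent t t') : Equivalent (t.graft f) (t'.graft f) := by
  induction h with
  | refl t => exact .refl _
  | symm _ ih => exact ih.symm
  | trans _ _ ih ih' => exact ih.trans ih'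
  | congrOp a m α b sq c c' _ ih => exact .congrOp _ _ _ _ _ _ _ ih
  | congrInv a b w sq c c' _ ih => exact .congrInv _ _ _ _ _ _ ih
  | permute a m α b sq c σ sq' => exact .permute a m α b sq (fun s => (c s).graft f) σ sq'
  | composeOp a m α b sq j β d sq' c sq'' =>
    exact .composeOp a m α b sq j β d sq' (fun s r => (c s r).graft f) sq''
  | composeInv a b b' w w' sq sq' c sq'' =>
    exact .composeInv a b b' w w' sq sq' (c.graft f) sq''
  | deleteOp a sq c => exact .deleteOp a sq (c.graft f)
  | deleteInv a sq c => exact .deleteInv a sq (c.graft f)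

theorem Equivalent.graft_right {f g : X → Hammock O W k Y 1} (h : ∀ x, Equivalent (f x) (g x))
    {a : Fin k → W} (t : Hammock O W k X a) : Equivalent (t.graft f) (t.graft g) := by
  induction t with
  | leaf a ha x => subst ha; exact h x
  | op a m α b sq c ih => exact .congrOp _ _ _ _ _ _ _ ih
  | inv a b w sq c ih => exact .congrInv _ _ _ _ _ _ ih

theorem Equivalent.map (φ : O ⟶ P) (hφ : ∀ w ∈ W, φ.app w ∈ V) {a : Fin k → W}
    {t t' : Hammock O W k X a} (h : Equivalent t t') :
    ∀ a' h', Equivalent (t.map φ hφ a' h') (t'.map φ hφ a' h') := by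
  induction h with
  | refl t => intros; exact .refl _
  | symm _ ih => intro a' h'; exact (ih a' h').symm
  | trans _ _ ih ih' => intro a' h'; exact (ih a' h').trans (ih' a' h')
  | congrOp a m α b sq c c' _ ih =>
    intro a' h'; exact .congrOp _ _ _ _ _ _ _ (fun s => ih s _ _)
  | congrInv a b w sq c c' _ ih =>
    intro a' h'; exact .congrInv _ _ _ _ _ _ (ih _ _)
  | permute a m α b sq c σ sq' =>
    intro a' h'
    have e : (fun i => φ.app (O.act (α i) σ)) = fun i => P.act (φ.app (α i)) σ :=
      funext fun i => φ.map_act _ _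
    have sq₂ := sq'.map φ hφ h'
    rw [e] at sq₂
    exact (Equivalent.permute a' m (fun i => φ.app (α i)) _ (sq.map φ hφ h')
      (fun s => (c s).map φ hφ _ rfl) σ sq₂).trans
      (.of_eq (op_congr e.symm rfl (fun s => HEq.rfl)))
  | composeOp a m α b sq j β d sq' c sq'' =>
    intro a' h'
    have e : (fun i => φ.app (O.comp (α i) (fun s => β s i))) =
        fun i => P.comp (φ.app (α i)) (fun s => φ.app (β s i)) :=
      funext fun i => φ.map_comp _ _
    have sq₂ := sq''.map φ hφ h'
    rw [e] at sq₂
    exact (Equivalent.composeOp a' m (fun i => φ.app (α i)) _ (sq.map φ hφ h') j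
      (fun s i => φ.app (β s i)) (fun s r i => restrictUnary φ hφ (d s r i))
      (fun s => (sq' s).map φ hφ rfl) (fun s r => (c s r).map φ hφ _ rfl) sq₂).trans
      (.of_eq (op_congr e.symm rfl (fun s => HEq.rfl)))
  | composeInv a b b' w w' sq sq' c sq'' =>
    intro a' h'
    have e : (fun i => restrictUnary φ hφ (w' i * w i)) =
        fun i => restrictUnary φ hφ (w' i) * restrictUnary φ hφ (w i) :=
      funext fun i => map_mul _ _ _
    have sq₂ := sq''.map φ hφ h'
    rw [e] at sq₂
    exact (Equivalent.composeInv a' _ _ (fun i => restrictUnary φ hφ (w i)) _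
      (sq.map φ hφ h') (sq'.map φ hφ rfl) (c.map φ hφ _ rfl) sq₂).trans
      (.of_eq (inv_congr e.symm rfl HEq.rfl))
  | deleteOp a sq c =>
    intro a' h'
    subst h'
    have e : (fun _ => φ.app O.one : Fin (k + 1) → P.Op 1) = fun _ => P.one :=
      funext fun i => φ.map_one
    have sq₂ := sq.map φ hφ rfl
    rw [e] at sq₂
    exact (Equivalent.of_eq (op_congr e rfl (fun s => HEq.rfl))).trans
      (.deleteOp _ sq₂ (c.map φ hφ _ rfl))
  | deleteInv a sq c =>
    intro a' h'
    subst h'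
    have e : (fun _ => restrictUnary φ hφ 1 : Fin (k + 1) → V) = fun _ => 1 :=
      funext fun i => map_one _
    have sq₂ := sq.map φ hφ rfl
    rw [e] at sq₂
    exact (Equivalent.of_eq (inv_congr e rfl HEq.rfl)).trans
      (.deleteInv _ sq₂ (c.map φ hφ _ rfl))

theorem Equivalent.reindex (θ : Fin (l + 1) →o Fin (k + 1)) {a : Fin k → W}
    {t t' : Hammock O W k X a} (h : Equivalent t t') :
    ∀ a' h', Equivalent (t.reindex θ a' h') (t'.reindex θ a' h') := by
  induction h with
  | refl t => intros; exact .refl _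
  | symm _ ih => intro a' h'; exact (ih a' h').symm
  | trans _ _ ih ih' => intro a' h'; exact (ih a' h').trans (ih' a' h')
  | congrOp a m α b sq c c' _ ih =>
    intro a' h'; exact .congrOp _ _ _ _ _ _ _ (fun s => ih s _ _)
  | congrInv a b w sq c c' _ ih =>
    intro a' h'; exact .congrInv _ _ _ _ _ _ (ih _ _)
  | permute a m α b sq c σ sq' =>
    intro a' h'
    exact .permute a' m (fun i => α (θ i)) _ (sq.reindex θ h')
      (fun s => (c s).reindex θ _ rfl) σ (sq'.reindex θ h')
  | composeOp a m α b sq j β d sq' c sq'' =>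
    intro a' h'
    exact .composeOp a' m (fun i => α (θ i)) _ (sq.reindex θ h') j
      (fun s i => β s (θ i)) (fun s r => reindexVert θ (d s r))
      (fun s => (sq' s).reindex θ rfl) (fun s r => (c s r).reindex θ _ rfl)
      (sq''.reindex θ h')
  | composeInv a b b' w w' sq sq' c sq'' =>
    intro a' h'
    exact .composeInv a' _ _ (fun i => w (θ i)) (fun i => w' (θ i))
      (sq.reindex θ h') (sq'.reindex θ rfl) (c.reindex θ _ rfl) (sq''.reindex θ h')
  | deleteOp a sq c =>
    intro a' h'
    subst h'
    exact .deleteOp _ (sq.reindex θ rfl) (c.reindex θ _ rfl)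
  | deleteInv a sq c =>
    intro a' h'
    subst h'
    exact .deleteInv _ (sq.reindex θ rfl) (c.reindex θ _ rfl)

end

end Hammock

/-- Tree hammocks of height `k` (not necessarily reduced) whose labeled leaves are labeled
bijectively by `Fin n`, and with identities as vertical arrows at the root (and at all labeled
leaves). -/
def TreeHammock (O : SymmOperad.{u}) (W : Submonoid (O.Op 1)) (k n : ℕ) : Type u :=
  {t : Hammock O W k (Fin n) 1 // t.labels = (Finset.univ : Finset (Fin n)).val}

namespace TreeHammock

section

variable {O P Q : SymmOperad.{u}} {W : Submonoid (O.Op 1)} {V : Submonoid (P.Op 1)}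
  {U : Submonoid (Q.Op 1)} {k l p n : ℕ}

instance setoid (O : SymmOperad.{u}) (W : Submonoid (O.Op 1)) (k n : ℕ) :
    Setoid (TreeHammock O W k n) where
  r t t' := Hammock.Equivalent t.1 t'.1
  iseqv := ⟨fun _ => .refl _, fun h => h.symm, fun h h' => h.trans h'⟩

/-- The trivial tree. -/
def unit (O : SymmOperad.{u}) (W : Submonoid (O.Op 1)) (k : ℕ) : TreeHammock O W k 1 :=
  ⟨.leaf 1 rfl 0, rfl⟩

/-- Relabeling of the labeled leaves along a bijection. -/
def relabel {m : ℕ} (e : Fin m ≃ Fin n) (t : TreeHammock O W k m) : TreeHammock O W k n :=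
  ⟨t.1.relabel e, by
    rw [Hammock.labels_relabel, t.2]
    exact congrArg Finset.val (Finset.map_univ_equiv e)⟩

/-- Grafting of `t₁, …, tₘ` on the leaves of `t` with labels `1, …, m`; the labels of the resulting
leaves are shifted as in the usual block ordering. -/
def graft {m : ℕ} {j : Fin m → ℕ} (t : TreeHammock O W k m) (f : ∀ s, TreeHammock O W k (j s)) :
    TreeHammock O W k (∑ s, j s) :=
  ⟨t.1.graft (fun s => (f s).1.relabel (fun y => finSigmaFinEquiv ⟨s, y⟩)), by
    rw [Hammock.labels_graft, t.2]
    simp only [Hammock.labels_relabel, (f _).2]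
    have e : (Finset.univ : Finset (Fin (∑ s, j s))) =
        (Finset.univ.sigma fun _ => Finset.univ).map
          (finSigmaFinEquiv (n := j)).toEmbedding := by
      rw [Finset.univ_sigma_univ, Finset.map_univ_equiv]
    rw [e]
    rw [Finset.map_val]
    change _ = Multiset.map (fun z => finSigmaFinEquiv z)
      (Multiset.sigma (Finset.univ : Finset (Fin m)).val
        (fun s => (Finset.univ : Finset (Fin (j s))).val))
    rw [Multiset.sigma]
    rw [Multiset.map_bind]
    simp only [Multiset.map_map]
    rfl⟩

/-- The corolla with label `x` in all planes and with identities as vertical arrows. -/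
def corolla (W : Submonoid (O.Op 1)) (k : ℕ) (x : O.Op n) : TreeHammock O W k n :=
  ⟨.op 1 n (fun _ => x) (fun _ => 1)
    (fun _ => (O.compUnary_one x).trans (O.one_unaryComp x).symm) (fun s => .leaf 1 rfl s), by
    have h : ∀ s : Finset (Fin n), ∑ i ∈ s, ({i} : Multiset (Fin n)) = s.val := by
      intro s
      simp [← Finset.sum_multiset_singleton]
    exact h _⟩

/-- Application of a map of operads to all labels. -/
def map (φ : O ⟶ P) (hφ : ∀ w ∈ W, φ.app w ∈ V) (t : TreeHammock O W k n) :
    TreeHammock P V k n :=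
  ⟨t.1.map φ hφ 1 (Hammock.one_eq_map_one φ hφ), by rw [Hammock.labels_map, t.2]⟩

/-- The simplicial operator in the height direction. -/
def reindex (θ : Fin (l + 1) →o Fin (k + 1)) (t : TreeHammock O W k n) : TreeHammock O W l n :=
  ⟨t.1.reindex θ 1 (reindexVert_one θ).symm, by rw [Hammock.labels_reindex, t.2]⟩

theorem graft_congr {m : ℕ} {j : Fin m → ℕ} {t t' : TreeHammock O W k m}
    {f f' : ∀ s, TreeHammock O W k (j s)} (h : t ≈ t') (h' : ∀ s, f s ≈ f' s) :
    graft t f ≈ graft t' f' :=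
  (h.graft_left _).trans (.graft_right (fun s => (h' s).relabel _) _)

end

end TreeHammock

theorem finSigma_assoc {k : ℕ} (j : Fin k → ℕ) (i : Fin (∑ s, j s) → ℕ) (s : Fin k)
    (t : Fin (j s)) (r : Fin (i (finSigmaFinEquiv ⟨s, t⟩))) :
    ((finSigmaFinEquiv ⟨finSigmaFinEquiv ⟨s, t⟩, r⟩ : Fin (∑ z, i z)) : ℕ) =
      (finSigmaFinEquiv (n := fun s => ∑ t, i (finSigmaFinEquiv ⟨s, t⟩))
        ⟨s, finSigmaFinEquiv (n := fun t => i (finSigmaFinEquiv ⟨s, t⟩)) ⟨t, r⟩⟩ : ℕ) := by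
  have val : ∀ {K : ℕ} (J : Fin K → ℕ) (x : Fin K) (y : Fin (J x)),
      ((finSigmaFinEquiv ⟨x, y⟩ : Fin (∑ z, J z)) : ℕ) =
        (∑ z, if z < x then J z else 0) + y := by
    intro K J x y
    rw [finSigmaFinEquiv_apply, Finset.sum_ite, Finset.sum_const_zero, add_zero]
    congr 1
    refine Finset.sum_bij (fun z _ => Fin.castLE x.2.le z) ?_ ?_ ?_ ?_
    · intro z _
      exact Finset.mem_filter.mpr ⟨Finset.mem_univ _, z.2⟩
    · intro z _ z' _ h; simpa [Fin.ext_iff] using h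
    · intro z hz
      have hz' : (z : ℕ) < x := (Finset.mem_filter.mp hz).2
      exact ⟨⟨z, hz'⟩, Finset.mem_univ _, rfl⟩
    · intro z _; rfl
  have lt : ∀ (s' : Fin k) (t' : Fin (j s')),
      ((finSigmaFinEquiv ⟨s', t'⟩ : Fin (∑ z, j z)) < finSigmaFinEquiv ⟨s, t⟩) ↔
        (s' < s ∨ ∃ h : s' = s, h ▸ t' < t) := by
    have mono : ∀ (s₁ s₂ : Fin k) (t₁ : Fin (j s₁)) (t₂ : Fin (j s₂)), s₁ < s₂ →
        (finSigmaFinEquiv ⟨s₁, t₁⟩ : Fin (∑ z, j z)) < finSigmaFinEquiv ⟨s₂, t₂⟩ := by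
      intro s₁ s₂ t₁ t₂ h
      rw [Fin.lt_def, val, val]
      have h1 : (∑ z, if z < s₁ then j z else 0) + j s₁ ≤ ∑ z, if z < s₂ then j z else 0 := by
        rw [← Finset.sum_erase_add _ _ (Finset.mem_univ s₁)]
        rw [← Finset.sum_erase_add Finset.univ (fun z => if z < s₂ then j z else 0)
          (Finset.mem_univ s₁)]
        simp only [lt_irrefl, if_false, h, if_true, add_zero]
        apply Nat.add_le_add_right
        apply Finset.sum_le_sum
        intro z _
        by_cases hz : z < s₁
        · simp [hz, hz.trans h]
        · simp [hz]
      have := t₁.2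
      omega
    intro s' t'
    rcases lt_trichotomy s' s with h | h | h
    · simp [h, mono s' s t' t h]
    · subst h
      rw [Fin.lt_def, val, val]
      simp
    · have := mono s s' t t' h
      simp only [not_lt.mpr h.le, h.ne', not_lt.mpr this.le, false_or]
      simp
  rw [val, val, val]
  rw [← Equiv.sum_comp finSigmaFinEquiv, Fintype.sum_sigma]
  simp only [lt]
  rw [← add_assoc]
  congr 1
  rw [← Finset.sum_erase_add _ _ (Finset.mem_univ s)]
  rw [← Finset.sum_erase_add Finset.univ
    (fun z => if z < s then ∑ t, i (finSigmaFinEquiv ⟨z, t⟩) else 0) (Finset.mem_univ s)]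
  simp only [lt_irrefl, if_false, add_zero, false_or]
  congr 1
  · apply Finset.sum_congr rfl
    intro z hz
    have hz' : z ≠ s := Finset.ne_of_mem_erase hz
    by_cases h : z < s
    · simp [h]
    · simp [h, hz']
  · simp

namespace TreeHammock

section

variable {O P Q : SymmOperad.{u}} {W : Submonoid (O.Op 1)} {V : Submonoid (P.Op 1)}
  {U : Submonoid (Q.Op 1)} {k l p n : ℕ}

/-- Equivalence classes of tree hammocks of height `k`; each class contains a reduced tree hammock
which is unique up to changes of the planar structure. -/
def Class (O : SymmOperad.{u}) (W : Submonoid (O.Op 1)) (k n : ℕ) : Type u :=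
  Quotient (setoid O W k n)

/-- The class of a tree hammock. -/
def cls (t : TreeHammock O W k n) : Class O W k n := Quotient.mk _ t

theorem cls_eq {t t' : TreeHammock O W k n} (h : t.1 = t'.1) : cls t = cls t' :=
  congrArg cls (Subtype.ext h)

namespace Class

theorem ind {p : Class O W k n → Prop} (h : ∀ t, p (cls t)) (x : Class O W k n) : p x :=
  Quotient.ind h x

/-- `σ` acts by relabeling the labeled leaves. -/
def act (x : Class O W k n) (σ : Equiv.Perm (Fin n)) : Class O W k n :=
  Quotient.map (relabel σ.symm) (fun _ _ h => Hammock.Equivalent.relabel _ h) x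

/-- Operadic composition by grafting; see `comp_cls`. -/
noncomputable def comp {m : ℕ} {j : Fin m → ℕ} (x : Class O W k m)
    (y : ∀ s, Class O W k (j s)) : Class O W k (∑ s, j s) :=
  Quotient.map (fun t => graft t (fun s => Quotient.out (y s)))
    (fun _ _ h => graft_congr h (fun _ => Setoid.refl _)) x

theorem comp_cls {m : ℕ} {j : Fin m → ℕ} (t : TreeHammock O W k m)
    (f : ∀ s, TreeHammock O W k (j s)) : comp (cls t) (fun s => cls (f s)) = cls (graft t f) :=
  Quotient.sound (graft_congr (Setoid.refl _) (fun s => Quotient.mk_out (f s)))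

/-- Application of a map of operads to all labels. -/
def map (φ : O ⟶ P) (hφ : ∀ w ∈ W, φ.app w ∈ V) (x : Class O W k n) : Class P V k n :=
  Quotient.map (TreeHammock.map φ hφ) (fun _ _ h => Hammock.Equivalent.map φ hφ h _ _) x

/-- The simplicial operator in the height direction. -/
def reindex (θ : Fin (l + 1) →o Fin (k + 1)) (x : Class O W k n) : Class O W l n :=
  Quotient.map (TreeHammock.reindex θ) (fun _ _ h => Hammock.Equivalent.reindex θ h _ _) x

theorem castArity_cls {m : ℕ} (h : m = n) (t : TreeHammock O W k m) :
    castArity h (cls t) = cls (relabel (finCongr h) t) := by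
  subst h
  exact cls_eq (Hammock.relabel_id t.1).symm

theorem ind_pi {m : ℕ} {j : Fin m → ℕ} {p : (∀ s, Class O W k (j s)) → Prop}
    (h : ∀ f : ∀ s, TreeHammock O W k (j s), p (fun s => cls (f s)))
    (y : ∀ s, Class O W k (j s)) : p y := by
  have e : y = fun s => cls (Quotient.out (y s)) := funext fun s => (Quotient.out_eq _).symm
  rw [e]
  exact h _

end Class

end

end TreeHammock

open TreeHammock in
/-- The operad in sets whose operations are the (classes of) tree hammocks of height `k`. -/
noncomputable def hammockOperad (O : SymmOperad.{u}) (W : Submonoid (O.Op 1)) (k : ℕ) :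
    SymmOperad.{u} where
  Op n := Class O W k n
  one := cls (unit O W k)
  act := Class.act
  comp := Class.comp
  act_one x := by
    induction x using Class.ind with | _ t =>
    exact cls_eq (Hammock.relabel_id t.1)
  act_mul x σ τ := by
    induction x using Class.ind with | _ t =>
    exact cls_eq (Hammock.relabel_relabel σ.symm τ.symm t.1).symm
  one_comp h x := by
    induction x using Class.ind with | _ t =>
    refine (congrArg (castArity h) (Class.comp_cls _ _)).trans ((Class.castArity_cls h _).trans ?_)
    refine cls_eq ((Hammock.relabel_relabel _ _ t.1).trans ?_)
    refine Eq.trans ?_ (Hammock.relabel_id t.1)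
    congr 1
    funext y
    ext
    simp
  comp_one h x := by
    induction x using Class.ind with | _ t =>
    refine (congrArg (castArity h) (Class.comp_cls _ _)).trans ((Class.castArity_cls h _).trans ?_)
    refine cls_eq ((congrArg _ (Hammock.graft_leaf _ t.1)).trans
      ((Hammock.relabel_relabel _ _ t.1).trans ?_))
    refine Eq.trans ?_ (Hammock.relabel_id t.1)
    congr 1
    funext y
    ext
    simp
  assoc {k' j i} x y z := by
    induction x using Class.ind with | _ t =>
    induction y using Class.ind_pi with | _ f =>
    induction z using Class.ind_pi with | _ g =>
    simp only [Class.comp_cls]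
    rw [Class.castArity_cls]
    refine cls_eq ?_
    simp only [relabel, graft, Hammock.relabel_graft, Hammock.graft_graft, Hammock.graft_relabel,
      Hammock.relabel_relabel]
    congr 1
    funext s
    congr 1
    funext r
    congr 1
    funext q
    ext
    exact finSigma_assoc j i s r q
  act_comp {k' j} σ x y := by
    induction x using Class.ind with | _ t =>
    induction y using Class.ind_pi with | _ f =>
    have e : Class.act (cls t) σ = cls (relabel σ.symm t) := rfl
    rw [e]
    simp only [Class.comp_cls]
    rw [Class.castArity_cls]
    refine cls_eq ?_
    simp only [relabel, graft, Hammock.relabel_graft, Hammock.graft_relabel,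
      Hammock.relabel_relabel]
    congr 1
    funext s
    congr 1
    funext q
    simp only [Function.comp]
    rw [Equiv.eq_symm_apply]
    simp only [blockPerm, Equiv.trans_apply, Equiv.symm_apply_apply]
    congr 2
    rw [← Equiv.eq_symm_apply]
    rfl
  comp_act {k' j} τ x y := by
    induction x using Class.ind with | _ t =>
    induction y using Class.ind_pi with | _ f =>
    have e : ∀ s, Class.act (cls (f s)) (τ s) = cls (relabel (τ s).symm (f s)) := fun s => rfl
    simp only [e, Class.comp_cls]
    refine cls_eq ?_
    simp only [relabel, graft, Hammock.relabel_graft, Hammock.relabel_relabel]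
    congr 1
    funext s
    congr 1
    funext q
    simp only [Function.comp]
    rw [Equiv.eq_symm_apply]
    simp [blockSum]

namespace hammockOperad

section

variable {O P Q : SymmOperad.{u}} {W : Submonoid (O.Op 1)} {V : Submonoid (P.Op 1)} {k l : ℕ}

open TreeHammock in
/-- The map of operads given by applying `φ` to all labels. -/
def map (φ : O ⟶ P) (hφ : ∀ w ∈ W, φ.app w ∈ V) (k : ℕ) :
    hammockOperad O W k ⟶ hammockOperad P V k where
  app := Class.map φ hφ
  map_one := rfl
  map_act x σ := by
    induction x using Class.ind with | _ t =>
    exact cls_eq (Hammock.map_relabel φ hφ _ t.1 _ _)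
  map_comp x y := by
    induction x using Class.ind with | _ t =>
    induction y using Class.ind_pi with | _ f =>
    refine (congrArg (Class.map φ hφ) (Class.comp_cls t f)).trans
      (Eq.trans ?_ (Class.comp_cls (TreeHammock.map φ hφ t)
        (fun s => TreeHammock.map φ hφ (f s))).symm)
    refine cls_eq ((Hammock.map_graft φ hφ _ t.1 _ _).trans ?_)
    simp only [Hammock.map_relabel]
    rfl

open TreeHammock in
/-- The simplicial operators in the height direction are maps of operads. -/
def reindex (W : Submonoid (O.Op 1)) (θ : Fin (l + 1) →o Fin (k + 1)) :
    hammockOperad O W k ⟶ hammockOperad O W l where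
  app := Class.reindex θ
  map_one := rfl
  map_act x σ := by
    induction x using Class.ind with | _ t =>
    exact cls_eq (Hammock.reindex_relabel θ _ t.1 _ _)
  map_comp x y := by
    induction x using Class.ind with | _ t =>
    induction y using Class.ind_pi with | _ f =>
    refine (congrArg (Class.reindex θ) (Class.comp_cls t f)).trans
      (Eq.trans ?_ (Class.comp_cls (TreeHammock.reindex θ t)
        (fun s => TreeHammock.reindex θ (f s))).symm)
    refine cls_eq ((Hammock.reindex_graft θ _ t.1 _ _).trans ?_)
    simp only [Hammock.reindex_relabel]
    rfl

open TreeHammock in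
theorem map_eq_id (φ : O ⟶ O) (hφ : ∀ w ∈ W, φ.app w ∈ W) (h : φ = 𝟙 O) :
    map φ hφ k = 𝟙 _ := by
  subst h
  apply SymmOperad.hom_ext
  intro n z
  induction z using Class.ind with | _ t =>
  exact cls_eq (Hammock.map_id t.1 _ _ rfl)

open TreeHammock in
theorem map_comp_eq {U : Submonoid (Q.Op 1)} (φ : O ⟶ P) (hφ : ∀ w ∈ W, φ.app w ∈ V) (ψ : P ⟶ Q)
    (hψ : ∀ v ∈ V, ψ.app v ∈ U) (χ : O ⟶ Q) (hχ : ∀ w ∈ W, χ.app w ∈ U) (h : χ = φ ≫ ψ) :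
    map φ hφ k ≫ map ψ hψ k = map χ hχ k := by
  subst h
  apply SymmOperad.hom_ext
  intro n z
  induction z using Class.ind with | _ t =>
  exact cls_eq (Hammock.map_map φ hφ ψ hψ t.1 _ _ _ _ (Hammock.one_eq_map_one (φ ≫ ψ) hχ))

open TreeHammock in
theorem reindex_id : reindex W (OrderHom.id : Fin (k + 1) →o Fin (k + 1)) = 𝟙 _ := by
  apply SymmOperad.hom_ext
  intro n z
  induction z using Class.ind with | _ t =>
  exact cls_eq (eq_of_heq (Hammock.reindex_id t.1 _ _))

open TreeHammock in
theorem reindex_comp {p : ℕ} (η : Fin (p + 1) →o Fin (l + 1)) (θ : Fin (l + 1) →o Fin (k + 1)) :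
    reindex W θ ≫ reindex W η = reindex W (θ.comp η) := by
  apply SymmOperad.hom_ext
  intro n z
  induction z using Class.ind with | _ t =>
  exact cls_eq (Hammock.reindex_reindex η θ t.1 _ _ _ _ _)

open TreeHammock in
theorem reindex_map (φ : O ⟶ P) (hφ : ∀ w ∈ W, φ.app w ∈ V) (θ : Fin (l + 1) →o Fin (k + 1)) :
    reindex W θ ≫ map φ hφ l = map φ hφ k ≫ reindex V θ := by
  apply SymmOperad.hom_ext
  intro n z
  induction z using Class.ind with | _ t =>
  exact cls_eq (Hammock.map_reindex φ hφ θ t.1 _ _ _ _ _ _ _)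

end

end hammockOperad

/-! ### The tree hammock localization of a simplicial operad -/

/-- An operad in simplicial sets, that is, a simplicial object in the category of operads in sets
(products of simplicial sets are formed levelwise). -/
abbrev SimplicialOperad := SimplicialObject SymmOperad.{u}

/-- An operad in bisimplicial sets. -/
abbrev BisimplicialOperad := (SimplexCategory × SimplexCategory)ᵒᵖ ⥤ SymmOperad.{u}

/-- A simplicial operad `𝒪` with a (simplicial) sub-monoid `𝒲` of `𝒪(1)`. -/
structure SimplicialPair where
  operad : SimplicialOperad.{u}
  W : ∀ x : SimplexCategoryᵒᵖ, Submonoid ((operad.obj x).Op 1)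
  map_mem : ∀ {x y : SimplexCategoryᵒᵖ} (f : x ⟶ y), ∀ w ∈ W x, (operad.map f).app w ∈ W y

namespace SimplicialPair

/-- A map of simplicial operads `φ : 𝒪 ⟶ 𝒪'` with `φ(𝒲) ⊆ 𝒲'`. -/
@[ext]
structure Hom (P Q : SimplicialPair.{u}) where
  operadMap : P.operad ⟶ Q.operad
  mem : ∀ x, ∀ w ∈ P.W x, (operadMap.app x).app w ∈ Q.W x

instance : Category SimplicialPair.{u} where
  Hom := Hom
  id P := ⟨𝟙 _, fun _ _ hw => hw⟩
  comp f g := ⟨f.operadMap ≫ g.operadMap, fun x _ hw => g.mem x _ (f.mem x _ hw)⟩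

/-- The pair `(𝒪, {1})`. -/
def trivial (O : SimplicialOperad.{u}) : SimplicialPair.{u} where
  operad := O
  W _ := ⊥
  map_mem f w hw := by
    rw [Submonoid.mem_bot] at hw ⊢
    subst hw
    exact (O.map f).map_one

/-- The map of pairs `(𝒪, {1}) ⟶ (𝒪, 𝒲)` which is the identity on `𝒪`. -/
def fromTrivial (P : SimplicialPair.{u}) : trivial P.operad ⟶ P where
  operadMap := 𝟙 _
  mem x w hw := by
    have h : w = 1 := Submonoid.mem_bot.mp hw
    subst h
    exact (P.W x).one_mem

/-- A simplicial operad as a bisimplicial operad which is constant in the second direction. -/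
def const : SimplicialOperad.{u} ⥤ BisimplicialOperad.{u} :=
  (Functor.whiskeringLeft _ _ _).obj (CategoryTheory.Prod.fst SimplexCategory SimplexCategory).op

open TreeHammock in
/-- The tree hammock localization of `𝒪` with respect to `𝒲`, an operad in bisimplicial sets. In
bidegree `(p, q)` it consists of the tree hammocks of height `q` in the operad of `p`-simplices
of `𝒪`. -/
noncomputable def treeHammockLocalization (P : SimplicialPair.{u}) : BisimplicialOperad.{u} where
  obj x := hammockOperad (P.operad.obj (.op x.unop.1)) (P.W _) x.unop.2.len
  map f := hammockOperad.map (P.operad.map f.unop.1.op) (P.map_mem f.unop.1.op) _ ≫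
    hammockOperad.reindex _ f.unop.2.toOrderHom
  map_id x := by
    have h := hammockOperad.map_eq_id (k := x.unop.2.len) (P.operad.map (𝟙 x : x ⟶ x).unop.1.op)
      (P.map_mem (𝟙 x : x ⟶ x).unop.1.op) (P.operad.map_id _)
    exact (congrArg (· ≫ _) h).trans ((Category.id_comp _).trans hammockOperad.reindex_id)
  map_comp {x y z} f g := by
    have h := hammockOperad.map_comp_eq (k := x.unop.2.len)
      (P.operad.map f.unop.1.op) (P.map_mem f.unop.1.op)
      (P.operad.map g.unop.1.op) (P.map_mem g.unop.1.op)
      (P.operad.map (f ≫ g).unop.1.op) (P.map_mem (f ≫ g).unop.1.op)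
      (P.operad.map_comp f.unop.1.op g.unop.1.op)
    have h' := hammockOperad.reindex_comp (W := P.W (.op z.unop.1)) g.unop.2.toOrderHom
      f.unop.2.toOrderHom
    have h'' := hammockOperad.reindex_map (P.operad.map g.unop.1.op) (P.map_mem g.unop.1.op)
      f.unop.2.toOrderHom
    rw [← h, Category.assoc, Category.assoc, ← Category.assoc (hammockOperad.reindex _ _), h'',
      Category.assoc, h']
    rfl

/-- The tree hammocks (not necessarily reduced) in bidegree `x = (p, q)` with `n` labeled leaves. -/
abbrev Hammocks (P : SimplicialPair.{u}) (x : (SimplexCategory × SimplexCategory)ᵒᵖ) (n : ℕ) :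
    Type u :=
  TreeHammock (P.operad.obj (.op x.unop.1)) (P.W _) x.unop.2.len n

/-- The operation of the tree hammock localization which is represented by a tree hammock. -/
def cls (P : SimplicialPair.{u}) {x : (SimplexCategory × SimplexCategory)ᵒᵖ} {n : ℕ}
    (t : P.Hammocks x n) : (P.treeHammockLocalization.obj x).Op n :=
  TreeHammock.cls t

/-- Application of a map of pairs to all labels of a tree hammock. -/
def mapHammock {P Q : SimplicialPair.{u}} (φ : P ⟶ Q)
    {x : (SimplexCategory × SimplexCategory)ᵒᵖ} {n : ℕ} (t : P.Hammocks x n) : Q.Hammocks x n :=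
  TreeHammock.map (φ.operadMap.app _) (φ.mem _) t

/-- The corolla labeled by a `p`-simplex `α` of `𝒪(n)`, as a tree hammock of height `q` all planes
of which are equal. -/
def corolla (P : SimplicialPair.{u}) {x : (SimplexCategory × SimplexCategory)ᵒᵖ} {n : ℕ}
    (α : ((const.obj P.operad).obj x).Op n) : P.Hammocks x n :=
  TreeHammock.corolla (P.W _) _ α

end SimplicialPair

/-! Uniqueness of reduced representatives comes from an explicit normal form instead of a confluence
argument. Working from the leaves to the root, `LabeledTree.reduce` puts every subtree in normal
form, absorbs into a piece all pieces of the same direction grafted directly on it, and drops the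
result if it is a column of identities. To treat all branches at once, `expand` makes each subtree
start with a piece `1 → m`, inserting an identity column if necessary; one operadic composition then
absorbs everything, and `collapse` removes a superfluous identity. `expandInv` and `collapseInv` do
the same for pieces `1 ← 1`.

Three facts carry the first part. The normal form of a hammock is reduced, and is realized by a
hammock equivalent to it (`reduced_reduce`, `exists_equivalent_reduce`). Each generating move leaves
it unchanged up to planar isomorphism (`Equivalent.reduce_planarIso`): permutations by equivariance
of `γ`, composition of columns by associativity, deletion of identities by the unit laws. A reduced
tree is planar isomorphic to its own normal form (`Reduced.reduce_planarIso`). Hence equivalent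
reduced hammocks are planar isomorphic.

The normal form is computed on `LabeledTree`, where the type does not depend on the vertical arrows
at the root and there are no squares. Nothing is lost (`toTree_injective`): the arrows at a leaf
node of a piece are those at the root of the tree grafted there, and they are identities at labeled
leaves.

Functoriality follows because a map of pairs respects every generating move, and uniqueness of the
induced map because every simplex is the class of a hammock. For `η`, the moves themselves show that
corollas are compatible with unit, symmetries and composition. If `𝒲` is trivial, reduced hammocks
contain no pieces `1 ← 1`, so they are single corollas or the trivial tree, and the squares force
all planes to agree; this gives surjectivity. Injectivity is read off from the normal form of a
corolla. -/

namespace SymmOperad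

/-! ### Equivariance and associativity of composition, with arity casts absorbed into bijections -/

variable (O : SymmOperad.{u})

/-- The action of a bijection between possibly different finite ordinals. -/
def actEquiv {m m' : ℕ} (e : Fin m' ≃ Fin m) (x : O.Op m) : O.Op m' :=
  have h : m = m' := by simpa using (Fintype.card_congr e).symm
  O.act (castArity h x) (e.trans (finCongr h))

theorem actEquiv_perm {m : ℕ} (σ : Equiv.Perm (Fin m)) (x : O.Op m) :
    O.actEquiv σ x = O.act x σ := rfl

theorem actEquiv_refl {m : ℕ} (x : O.Op m) : O.actEquiv (Equiv.refl _) x = x := O.act_one x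

theorem actEquiv_finCongr {m m' : ℕ} (h : m' = m) (x : O.Op m) :
    O.actEquiv (finCongr h) x = castArity h.symm x := by
  subst h; exact O.act_one x

theorem actEquiv_trans {m m' m'' : ℕ} (e : Fin m' ≃ Fin m) (e' : Fin m'' ≃ Fin m') (x : O.Op m) :
    O.actEquiv e' (O.actEquiv e x) = O.actEquiv (e'.trans e) x := by
  obtain rfl : m' = m := by simpa using Fintype.card_congr e
  obtain rfl : m'' = m' := by simpa using Fintype.card_congr e'
  exact (O.act_mul x e e').symm

theorem castArity_apply {k : ℕ} {j : Fin k → ℕ} (y : ∀ s, O.Op (j s)) {s s' : Fin k}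
    (h : s' = s) (h' : j s' = j s) : castArity h' (y s') = y s := by
  subst h; rfl

/-- The bijection between sums of ordinals induced by a bijection between disjoint unions. -/
def sumEquiv {m m' : ℕ} {j : Fin m → ℕ} {j' : Fin m' → ℕ}
    (e : (Σ s, Fin (j' s)) ≃ Σ s, Fin (j s)) : Fin (∑ s, j' s) ≃ Fin (∑ s, j s) :=
  (finSigmaFinEquiv.symm.trans e).trans finSigmaFinEquiv

/-- This is `act_comp` with the inputs indexed by the source of the bijection. Treating arity casts
as actions of `finCongr` merges the cast and the block permutation of that axiom into one bijection,
so only bijections remain to be compared. -/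
theorem comp_actEquiv_left {m m' : ℕ} {j : Fin m → ℕ} (e : Fin m' ≃ Fin m) (x : O.Op m)
    (y : ∀ s, O.Op (j s)) :
    O.comp (O.actEquiv e x) (fun s => y (e s)) =
      O.actEquiv (sumEquiv (Equiv.sigmaCongrLeft (β := fun s => Fin (j s)) e)) (O.comp x y) := by
  obtain rfl : m' = m := by simpa using Fintype.card_congr e
  rw [actEquiv_perm, O.act_comp (j := fun s => j (e s))]
  have h1 : ∀ s, j s = j (e (e.symm s)) := fun s => by simp
  have h2 : (fun s => y (e (e.symm s))) = fun s => castArity (h1 s) (y s) := by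
    funext s
    exact (O.castArity_apply y (by simp) _).symm
  rw [h2, comp_castArity_right, castArity_castArity, ← actEquiv_perm,
    ← actEquiv_finCongr (h := (Equiv.sum_comp e j)), actEquiv_trans]
  congr 1
  ext z
  obtain ⟨⟨s, t⟩, rfl⟩ := finSigmaFinEquiv.surjective z
  simp only [sumEquiv, blockPerm, Equiv.trans_apply, Equiv.symm_apply_apply, finCongr_apply,
    Fin.val_cast]
  -- The two positions lie in sums over families of arities that agree only propositionally, so they
  -- are compared as natural numbers.
  have val : ∀ {j j' : Fin m' → ℕ} (_ : j = j') (s s') (t : Fin (j s)) (t' : Fin (j' s')),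
      s = s' → t.1 = t'.1 → (finSigmaFinEquiv (n := j) ⟨s, t⟩ : ℕ) =
        finSigmaFinEquiv (n := j') ⟨s', t'⟩ := by
    rintro j _ rfl s _ t t' rfl h
    rw [Fin.ext h]
  have val' : ∀ {f : Fin m' → Fin m'} {s s' : Fin m'} (h : s = s') (t : Fin (j (f s))),
      ((h ▸ t : Fin (j (f s'))) : ℕ) = t := by
    rintro f s _ rfl t
    rfl
  exact val (funext fun s => (h1 s).symm) _ _ _ _ rfl (val' _ _)

theorem comp_actEquiv_right {m : ℕ} {j j' : Fin m → ℕ} (e : ∀ s, Fin (j' s) ≃ Fin (j s))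
    (x : O.Op m) (y : ∀ s, O.Op (j s)) :
    O.comp x (fun s => O.actEquiv (e s) (y s)) =
      O.actEquiv (sumEquiv (Equiv.sigmaCongrRight e)) (O.comp x y) := by
  obtain rfl : j' = j := funext fun s => by simpa using Fintype.card_congr (e s)
  exact O.comp_act e x y

theorem compUnary_comp {k : ℕ} {j : Fin k → ℕ} (x : O.Op k) (y : ∀ s, O.Op (j s))
    (z : Fin (∑ s, j s) → O.Op 1) :
    O.compUnary (O.comp x y) z =
      O.comp x (fun s => O.compUnary (y s) (fun t => z (finSigmaFinEquiv ⟨s, t⟩))) := by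
  unfold compUnary
  rw [comp_castArity_right]
  refine castArity_congr _ _ (sum_sum_finSigma j (fun _ => 1)) ?_
  rw [O.assoc]

theorem castArity_eq_of_castArity_eq {Op : ℕ → Type u} {l m n : ℕ} (h : l = m) (h' : n = m)
    (h'' : l = n) {x : Op l} {y : Op n} (hxy : castArity h x = castArity h' y) :
    castArity h'' x = y := by
  subst h; subst h''; exact hxy

/-- Associativity with a middle level of one-ary operations: vertical arrows move from the leaf
nodes of the upper piece to the roots of the pieces grafted there. -/
theorem comp_compUnary {k : ℕ} {j : Fin k → ℕ} (x : O.Op k) (b : Fin k → O.Op 1)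
    (y : ∀ s, O.Op (j s)) :
    O.comp (O.compUnary x b) y = O.comp x (fun s => O.unaryComp (b s) (y s)) := by
  unfold compUnary unaryComp
  have hk : ∑ _s : Fin k, 1 = k := by simp
  have h1 : ∀ (s : Fin k) (t : Fin 1), Fin.cast hk
      (finSigmaFinEquiv (n := fun _ : Fin k => 1) ⟨s, t⟩) = s := fun s t => finSigma_const_one s t _
  rw [comp_castArity_left, comp_castArity_right (O := O) (j := fun s => ∑ _t : Fin 1, j s)]
  have h2 : ∀ s : Fin k, (fun t : Fin 1 => y (Fin.cast hk
      (finSigmaFinEquiv (n := fun _ : Fin k => 1) ⟨s, t⟩))) =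
      fun t => castArity (congrArg j (h1 s t)).symm (y s) :=
    fun s => funext fun t => (O.castArity_apply y (h1 s t).symm _).symm
  have h3 := O.assoc (j := fun _ : Fin k => 1) x b (fun r => y (Fin.cast hk r))
  simp only [h2, comp_castArity_right (O := O) (j := fun _ : Fin 1 => j _)] at h3
  rw [comp_castArity_right (O := O) (j := fun s => ∑ _t : Fin 1, j s)] at h3
  exact castArity_congr _ _ _ (castArity_eq_of_castArity_eq _ _
    (by simp [Fintype.sum_equiv (finCongr hk) (fun r => j (Fin.cast hk r)) j (fun _ => rfl)]) h3)

theorem comp_unaryComp {k : ℕ} {j : Fin k → ℕ} (a : O.Op 1) (x : O.Op k)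
    (y : ∀ s, O.Op (j s)) :
    O.comp (O.unaryComp a x) y = O.unaryComp a (O.comp x y) := by
  unfold unaryComp
  have hk : ∑ _s : Fin 1, k = k := by simp
  have h1 : ∀ (s : Fin 1) (t : Fin k), Fin.cast hk
      (finSigmaFinEquiv (n := fun _ : Fin 1 => k) ⟨s, t⟩) = t := by
    intro s t
    ext
    simp
  rw [comp_castArity_left]
  have h2 : ∀ s : Fin 1, (fun t : Fin k => y (Fin.cast hk
      (finSigmaFinEquiv (n := fun _ : Fin 1 => k) ⟨s, t⟩))) =
      fun t => castArity (congrArg j (h1 s t)).symm (y t) :=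
    fun s => funext fun t => (O.castArity_apply y (h1 s t).symm _).symm
  have h3 := O.assoc (j := fun _ : Fin 1 => k) a (fun _ => x) (fun r => y (Fin.cast hk r))
  simp only [h2, comp_castArity_right] at h3
  exact castArity_congr _ _ _ (castArity_eq_of_castArity_eq _ _
    (by simp [Fintype.sum_equiv (finCongr hk) (fun r => j (Fin.cast hk r)) j (fun _ => rfl)]) h3)

/-- For blocks of size one, the block permutation of `σ` is `σ` itself once `∑ 1 = k` is used to
identify the ordinals. -/
theorem compUnary_act {k : ℕ} (x : O.Op k) (σ : Equiv.Perm (Fin k)) (b : Fin k → O.Op 1) :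
    O.compUnary (O.act x σ) (fun s => b (σ s)) = O.act (O.compUnary x b) σ := by
  unfold compUnary
  rw [← actEquiv_perm, ← actEquiv_perm]
  have hk : ∑ _s : Fin k, 1 = k := by simp
  refine (congrArg _ (O.comp_actEquiv_left (j := fun _ => 1) σ x b)).trans ?_
  rw [← actEquiv_finCongr (h := hk.symm), ← actEquiv_finCongr (h := hk.symm), actEquiv_trans,
    actEquiv_trans]
  refine congrArg (fun e => O.actEquiv e _) (Equiv.ext fun z => Fin.ext ?_)
  obtain ⟨z, rfl⟩ := (finCongr hk).surjective z
  obtain ⟨⟨s, t⟩, rfl⟩ := finSigmaFinEquiv.surjective z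
  have h := finSigma_const_one s t hk
  have h' := finSigma_const_one (σ s) t hk
  have e : sumEquiv (j := fun _ => 1) (j' := fun _ => 1)
      (Equiv.sigmaCongrLeft (β := fun _ => Fin 1) σ) (finSigmaFinEquiv ⟨s, t⟩) =
      finSigmaFinEquiv ⟨σ s, t⟩ := by
    simp [sumEquiv, Equiv.sigmaCongrLeft]
  refine (congrArg Fin.val e).trans ((congrArg Fin.val h').trans ?_)
  exact congrArg (fun s => (σ s : ℕ)) h.symm

theorem unaryComp_act {k : ℕ} (a : O.Op 1) (x : O.Op k) (σ : Equiv.Perm (Fin k)) :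
    O.unaryComp a (O.act x σ) = O.act (O.unaryComp a x) σ := by
  unfold unaryComp
  rw [← actEquiv_perm, ← actEquiv_perm]
  have hk : ∑ _s : Fin 1, k = k := by simp
  refine (congrArg _ (O.comp_actEquiv_right (j := fun _ : Fin 1 => k) (fun _ => σ) a
    (fun _ => x))).trans ?_
  rw [← actEquiv_finCongr (h := hk.symm), ← actEquiv_finCongr (h := hk.symm), actEquiv_trans,
    actEquiv_trans]
  refine congrArg (fun e => O.actEquiv e _) (Equiv.ext fun z => Fin.ext ?_)
  obtain ⟨z, rfl⟩ := (finCongr hk).surjective z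
  obtain ⟨⟨s, t⟩, rfl⟩ := finSigmaFinEquiv.surjective z
  have h : ∀ t, Fin.cast hk (finSigmaFinEquiv (n := fun _ : Fin 1 => k) ⟨s, t⟩) = t := by
    intro t; ext; simp
  have e : sumEquiv (j := fun _ => k) (j' := fun _ => k)
      (Equiv.sigmaCongrRight (fun _ : Fin 1 => σ)) (finSigmaFinEquiv ⟨s, t⟩) =
      finSigmaFinEquiv ⟨s, σ t⟩ := by
    simp [sumEquiv]
  refine (congrArg Fin.val e).trans ((congrArg Fin.val (h (σ t))).trans ?_)
  exact congrArg (fun s => (σ s : ℕ)) (h t).symm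

end SymmOperad

/-! ### Commutative squares are preserved by the moves -/

section Squares

variable {O : SymmOperad.{u}} {W : Submonoid (O.Op 1)} {k : ℕ}

theorem OpSquares.act {m : ℕ} {a : Fin k → W} {α : Fin (k + 1) → O.Op m} {b : Fin m → Fin k → W}
    (sq : OpSquares a α b) (σ : Equiv.Perm (Fin m)) :
    OpSquares a (fun i => O.act (α i) σ) (fun s => b (σ s)) := by
  intro i
  refine (O.compUnary_act (α i.castSucc) σ (fun s => (b s i : O.Op 1))).trans ?_
  rw [sq i, O.unaryComp_act]

/-- Pasting of squares: the lower squares move the arrows `d` up to `b`, and the upper square moves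
`b` up to `a`. Hence the square condition demanded by the move `composeOp` always holds. -/
theorem OpSquares.comp {m : ℕ} {a : Fin k → W} {α : Fin (k + 1) → O.Op m} {b : Fin m → Fin k → W}
    (sq : OpSquares a α b) {j : Fin m → ℕ} {β : ∀ s, Fin (k + 1) → O.Op (j s)}
    {d : ∀ s, Fin (j s) → Fin k → W} (sq' : ∀ s, OpSquares (b s) (β s) (d s)) :
    OpSquares a (fun i => O.comp (α i) (fun s => β s i))
      (fun z => d (finSigmaFinEquiv.symm z).1 (finSigmaFinEquiv.symm z).2) := by
  intro i
  have h : ∀ s, (fun t => ((d (finSigmaFinEquiv.symm (finSigmaFinEquiv ⟨s, t⟩)).1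
      (finSigmaFinEquiv.symm (finSigmaFinEquiv (n := j) ⟨s, t⟩)).2 i : W) : O.Op 1)) =
      fun t => (d s t i : O.Op 1) := by
    intro s
    funext t
    exact congrArg (fun p : Σ s, Fin (j s) => (d p.1 p.2 i : O.Op 1))
      (finSigmaFinEquiv.symm_apply_apply ⟨s, t⟩)
  rw [O.compUnary_comp]
  simp only [h]
  rw [← O.comp_unaryComp, ← sq i, O.comp_compUnary]
  exact congrArg _ (funext fun s => sq' s i)

theorem OpSquares.one (a : Fin k → W) :
    OpSquares a (fun _ => O.one) (fun _ : Fin 1 => a) :=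
  fun i => (O.one_unaryComp (a i : O.Op 1)).trans (O.compUnary_one (a i : O.Op 1)).symm

theorem InvSquares.one (a : Fin k → W) : InvSquares a (fun _ => 1) a :=
  fun i => by rw [one_mul, mul_one]

/-- Pasting again. Since the pieces point towards the root, the label farther from the root is the
left factor. -/
theorem InvSquares.mul {a b b' : Fin k → W} {w w' : Fin (k + 1) → W} (sq : InvSquares a w b)
    (sq' : InvSquares b w' b') : InvSquares a (fun i => w' i * w i) b' := by
  intro i
  rw [mul_assoc, sq i, ← mul_assoc, sq' i, mul_assoc]

end Squares

/-! ### Labeled trees and their planar isomorphisms -/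

/-- Planar trees with the labels of a tree hammock, but without vertical arrows at the leaf nodes
and without any commutativity conditions. -/
inductive LabeledTree (O : SymmOperad.{u}) (W : Submonoid (O.Op 1)) (k : ℕ) (X : Type) : Type u
  | leaf (x : X)
  | op (a : Fin k → W) (m : ℕ) (α : Fin (k + 1) → O.Op m) (c : Fin m → LabeledTree O W k X)
  | inv (a : Fin k → W) (w : Fin (k + 1) → W) (c : LabeledTree O W k X)

namespace LabeledTree

variable {O : SymmOperad.{u}} {W : Submonoid (O.Op 1)} {k : ℕ} {X : Type}

/-- Equality up to changes of the planar structure. -/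
inductive PlanarIso : LabeledTree O W k X → LabeledTree O W k X → Prop
  | refl (r : LabeledTree O W k X) : PlanarIso r r
  | trans {r r' r'' : LabeledTree O W k X} : PlanarIso r r' → PlanarIso r' r'' → PlanarIso r r''
  | congrOp (a : Fin k → W) (m : ℕ) (α : Fin (k + 1) → O.Op m) (c c' : Fin m → LabeledTree O W k X) :
      (∀ s, PlanarIso (c s) (c' s)) → PlanarIso (op a m α c) (op a m α c')
  | congrInv (a : Fin k → W) (w : Fin (k + 1) → W) (c c' : LabeledTree O W k X) :
      PlanarIso c c' → PlanarIso (inv a w c) (inv a w c')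
  | permute (a : Fin k → W) (m : ℕ) (α : Fin (k + 1) → O.Op m) (c : Fin m → LabeledTree O W k X)
      (σ : Equiv.Perm (Fin m)) :
      PlanarIso (op a m α c) (op a m (fun i => O.act (α i) σ) (fun s => c (σ s)))

/-- A permutation is undone by its inverse. Symmetry is derived and not built into the relation, so
that inductions on planar isomorphisms can transport data from the left tree to the right one. -/
theorem PlanarIso.symm {r r' : LabeledTree O W k X} (h : PlanarIso r r') : PlanarIso r' r := by
  induction h with
  | refl r => exact .refl r
  | trans _ _ ih ih' => exact ih'.trans ih
  | congrOp a m α c c' _ ih => exact .congrOp a m α c' c ih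
  | congrInv a w c c' _ ih => exact .congrInv a w c' c ih
  | permute a m α c σ =>
    have h := PlanarIso.permute a m (fun i => O.act (α i) σ) (fun s => c (σ s)) σ⁻¹
    simpa [← O.act_mul, O.act_one] using h

theorem PlanarIso.of_eq_of_eq {r r' s s' : LabeledTree O W k X} (h : r = s) (h' : r' = s')
    (hs : PlanarIso s s') : PlanarIso r r' := h ▸ h' ▸ hs

/-- The root piece is `1 → m`. -/
def IsOp : LabeledTree O W k X → Prop
  | op _ _ _ _ => True
  | _ => False

/-- The root piece is `1 ← 1`. -/
def IsInv : LabeledTree O W k X → Prop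
  | inv _ _ _ => True
  | _ => False

/-- A column of operations together with the trees grafted on its leaf nodes. -/
structure Layer (O : SymmOperad.{u}) (W : Submonoid (O.Op 1)) (k : ℕ) (X : Type) where
  m : ℕ
  α : Fin (k + 1) → O.Op m
  c : Fin m → LabeledTree O W k X

/-! ### Layers: the operad laws up to permutation of the leaf nodes -/

namespace Layer

/-- The identity column. -/
def single (r : LabeledTree O W k X) : Layer O W k X := ⟨1, fun _ => O.one, fun _ => r⟩

theorem single_injective {r r' : LabeledTree O W k X} (h : single r = single r') : r = r' := by
  simp only [single, mk.injEq, heq_eq_eq, true_and] at h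
  exact congrFun h 0

/-- Composition of a column of operations with columns at its leaf nodes. -/
def comp {m : ℕ} (α : Fin (k + 1) → O.Op m) (E : Fin m → Layer O W k X) : Layer O W k X where
  m := ∑ s, (E s).m
  α := fun i => O.comp (α i) (fun s => (E s).α i)
  c := fun z => (E (finSigmaFinEquiv.symm z).1).c (finSigmaFinEquiv.symm z).2

theorem comp_c {m : ℕ} (α : Fin (k + 1) → O.Op m) (E : Fin m → Layer O W k X)
    (p : Σ s, Fin (E s).m) : (comp α E).c (finSigmaFinEquiv p) = (E p.1).c p.2 :=
  congrArg (fun p : Σ s, Fin (E s).m => (E p.1).c p.2) (finSigmaFinEquiv.symm_apply_apply p)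

/-- Equality of layers up to changes of the planar structure. -/
def Iso (E E' : Layer O W k X) : Prop :=
  ∃ e : Fin E'.m ≃ Fin E.m, (∀ i, E'.α i = O.actEquiv e (E.α i)) ∧
    ∀ s, PlanarIso (E.c (e s)) (E'.c s)

theorem Iso.refl (E : Layer O W k X) : Iso E E :=
  ⟨Equiv.refl _, fun _ => (O.actEquiv_refl _).symm, fun _ => .refl _⟩

theorem Iso.symm {E E' : Layer O W k X} : Iso E E' → Iso E' E := by
  rintro ⟨e, h, h'⟩
  refine ⟨e.symm, fun i => ?_, fun s => ?_⟩
  · rw [h, O.actEquiv_trans, Equiv.symm_trans_self, O.actEquiv_refl]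
  · simpa using (h' (e.symm s)).symm

theorem Iso.trans {E E' E'' : Layer O W k X} : Iso E E' → Iso E' E'' → Iso E E'' := by
  rintro ⟨e, h, h'⟩ ⟨f, g, g'⟩
  refine ⟨f.trans e, fun i => ?_, fun s => (h' (f s)).trans (g' s)⟩
  rw [g, h, O.actEquiv_trans]

theorem Iso.planarIso {E E' : Layer O W k X} (a : Fin k → W) :
    Iso E E' → PlanarIso (op a E.m E.α E.c) (op a E'.m E'.α E'.c) := by
  obtain ⟨m, α, c⟩ := E
  obtain ⟨m', α', c'⟩ := E'
  rintro ⟨e, h, h'⟩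
  dsimp only at e h h'
  obtain rfl : m' = m := Fin.equiv_iff_eq.mp ⟨e⟩
  have hα : α' = fun i => O.act (α i) e := funext h
  subst hα
  exact (PlanarIso.permute a _ α c e).trans (.congrOp _ _ _ _ _ h')

theorem Iso.comp {m : ℕ} (α : Fin (k + 1) → O.Op m) {E E' : Fin m → Layer O W k X}
    (h : ∀ s, Iso (E s) (E' s)) : Iso (comp α E) (comp α E') := by
  choose e h h' using h
  refine ⟨SymmOperad.sumEquiv (Equiv.sigmaCongrRight e), fun i => ?_, fun z => ?_⟩
  · refine Eq.trans ?_ (O.comp_actEquiv_right e (α i) (fun s => (E s).α i))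
    exact congrArg (O.comp (α i)) (funext fun s => h s i)
  · obtain ⟨p, rfl⟩ := finSigmaFinEquiv.surjective z
    have e' : SymmOperad.sumEquiv (Equiv.sigmaCongrRight e) (finSigmaFinEquiv p) =
        finSigmaFinEquiv ⟨p.1, e p.1 p.2⟩ := by
      simp [SymmOperad.sumEquiv]
    exact .of_eq_of_eq ((congrArg (Layer.comp α E).c e').trans (comp_c α E _)) (comp_c α E' p)
      (h' p.1 p.2)

/-- Equivariance of `γ`, with the block permutation as bijection of leaf nodes. It makes the normal
form invariant under `permute`. -/
theorem comp_act_iso {m : ℕ} (α : Fin (k + 1) → O.Op m) (E : Fin m → Layer O W k X)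
    (σ : Equiv.Perm (Fin m)) :
    Iso (comp α E) (comp (fun i => O.act (α i) σ) (fun s => E (σ s))) := by
  refine ⟨SymmOperad.sumEquiv (Equiv.sigmaCongrLeft (β := fun s => Fin (E s).m) σ), fun i => ?_,
    fun z => ?_⟩
  · exact O.comp_actEquiv_left σ (α i) (fun s => (E s).α i)
  · obtain ⟨p, rfl⟩ := finSigmaFinEquiv.surjective z
    have e' : SymmOperad.sumEquiv (Equiv.sigmaCongrLeft (β := fun s => Fin (E s).m) σ)
        (finSigmaFinEquiv p) = finSigmaFinEquiv ⟨σ p.1, p.2⟩ := by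
      simp [SymmOperad.sumEquiv, Equiv.sigmaCongrLeft]
    exact .of_eq_of_eq ((congrArg (comp α E).c e').trans (comp_c α E _))
      (comp_c (fun i => O.act (α i) σ) (fun s => E (σ s)) p) (.refl _)

/-- Associativity of `γ`. Both iterated compositions enumerate the leaf nodes lexicographically
(`finSigma_assoc`), so the bijection is a mere cast of arities. -/
theorem comp_comp_iso {m : ℕ} (α : Fin (k + 1) → O.Op m) (E : Fin m → Layer O W k X)
    (F : Fin (comp α E).m → Layer O W k X) :
    Iso (comp (comp α E).α F)
      (comp α (fun s => comp (E s).α (fun t => F (finSigmaFinEquiv ⟨s, t⟩)))) := by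
  have h := sum_sum_finSigma (fun s => (E s).m) (fun z => (F z).m)
  refine ⟨finCongr h.symm, fun i => ?_, fun z => ?_⟩
  · refine Eq.trans ?_ (O.actEquiv_finCongr h.symm _).symm
    exact (O.assoc (α i) (fun s => (E s).α i) (fun z => (F z).α i)).symm
  · obtain ⟨⟨s, z⟩, rfl⟩ := finSigmaFinEquiv.surjective z
    obtain ⟨⟨t, r⟩, rfl⟩ := finSigmaFinEquiv.surjective z
    have e : finCongr h.symm (finSigmaFinEquiv
        (n := fun s => ∑ t, (F (finSigmaFinEquiv ⟨s, t⟩)).m)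
        ⟨s, finSigmaFinEquiv (n := fun t => (F (finSigmaFinEquiv ⟨s, t⟩)).m) ⟨t, r⟩⟩) =
        finSigmaFinEquiv (n := fun z => (F z).m) ⟨finSigmaFinEquiv ⟨s, t⟩, r⟩ :=
      Fin.ext (finSigma_assoc (fun s => (E s).m) (fun z => (F z).m) s t r).symm
    have e₂ := comp_c α (fun s => comp (E s).α (fun t => F (finSigmaFinEquiv ⟨s, t⟩)))
      ⟨s, finSigmaFinEquiv ⟨t, r⟩⟩
    exact .of_eq_of_eq ((congrArg (comp (comp α E).α F).c e).trans (comp_c _ F _))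
      (e₂.trans (comp_c (E s).α (fun t => F (finSigmaFinEquiv ⟨s, t⟩)) ⟨t, r⟩)) (.refl _)

theorem one_comp_iso (E : Layer O W k X) :
    Iso (comp (fun _ => O.one) (fun _ : Fin 1 => E)) E := by
  have h : ∑ _s : Fin 1, E.m = E.m := by simp
  refine ⟨finCongr h.symm, fun i => ?_, fun z => ?_⟩
  · refine Eq.trans ?_ (O.actEquiv_finCongr h.symm _).symm
    exact (O.one_comp h (E.α i)).symm
  · have e : finCongr h.symm z = finSigmaFinEquiv (n := fun _ : Fin 1 => E.m) ⟨0, z⟩ := by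
      ext; simp
    exact .of_eq_of_eq ((congrArg (comp (fun _ => O.one) (fun _ : Fin 1 => E)).c e).trans
      (comp_c _ (fun _ : Fin 1 => E) ⟨0, z⟩)) rfl (.refl _)

theorem comp_single_iso (E : Layer O W k X) :
    Iso (comp E.α (fun s => single (E.c s))) E := by
  have h : ∑ _s : Fin E.m, 1 = E.m := by simp
  refine ⟨finCongr h.symm, fun i => ?_, fun z => ?_⟩
  · refine Eq.trans ?_ (O.actEquiv_finCongr h.symm _).symm
    exact (O.comp_one h (E.α i)).symm
  · have e : finCongr h.symm z = finSigmaFinEquiv (n := fun _ : Fin E.m => 1) ⟨z, 0⟩ := by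
      ext; simp
    exact .of_eq_of_eq ((congrArg (comp E.α (fun s => single (E.c s))).c e).trans
      (comp_c E.α (fun s => single (E.c s)) ⟨z, (0 : Fin 1)⟩)) rfl (.refl _)

theorem Iso.single {r r' : LabeledTree O W k X} (h : PlanarIso r r') :
    Iso (single r) (single r') :=
  ⟨Equiv.refl _, fun _ => (O.actEquiv_refl _).symm, fun _ => h⟩

/-- A set with one element has no nontrivial permutations, so being an identity layer is invariant
under isomorphism. Therefore the case distinction in `collapse` respects isomorphisms. -/
theorem Iso.of_single {r : LabeledTree O W k X} {E : Layer O W k X} :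
    Iso (Layer.single r) E → ∃ r', E = Layer.single r' ∧ PlanarIso r r' := by
  obtain ⟨m, α, c⟩ := E
  rintro ⟨e, h, h'⟩
  obtain rfl : m = 1 := Fin.equiv_iff_eq.mp ⟨e⟩
  obtain rfl : e = Equiv.refl _ := Subsingleton.elim _ _
  obtain rfl : α = fun _ => O.one := funext fun i => (h i).trans (O.actEquiv_refl _)
  exact ⟨c 0, congrArg _ (funext fun s => congrArg c (Subsingleton.elim _ _)), h' 0⟩

end Layer

/-! ### The normal form of a labeled tree -/

open Layer

/-- The root piece of a tree; a column of identities is inserted if it is not of the form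
`1 → m`. -/
def expand : LabeledTree O W k X → Layer O W k X
  | op _ m α c => ⟨m, α, c⟩
  | leaf x => single (leaf x)
  | inv a w c => single (inv a w c)

open Classical in
/-- The tree with prescribed root piece, which is omitted if it consists of identities. -/
noncomputable def collapse (a : Fin k → W) (E : Layer O W k X) : LabeledTree O W k X :=
  if h : ∃ r, E = single r then h.choose else op a E.m E.α E.c

/-- The root piece `1 ← 1` of a tree; a column of identities is inserted if there is no such
piece. -/
def expandInv : LabeledTree O W k X → (Fin (k + 1) → W) × LabeledTree O W k X
  | inv _ w c => (w, c)
  | leaf x => (1, leaf x)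
  | op a m α c => (1, op a m α c)

open Classical in
/-- The tree with prescribed root piece `1 ← 1`, which is omitted if it consists of identities. -/
noncomputable def collapseInv (a : Fin k → W) (w : Fin (k + 1) → W) (r : LabeledTree O W k X) :
    LabeledTree O W k X :=
  if w = 1 then r else inv a w r

theorem collapse_single (a : Fin k → W) (r : LabeledTree O W k X) : collapse a (single r) = r := by
  have h : ∃ r', single r = single r' := ⟨r, rfl⟩
  rw [collapse, dif_pos h]
  exact (single_injective h.choose_spec).symm

theorem collapse_of_ne (a : Fin k → W) {E : Layer O W k X} (h : ∀ r, E ≠ single r) :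
    collapse a E = op a E.m E.α E.c :=
  dif_neg (fun ⟨r, hr⟩ => h r hr)

theorem collapse_planarIso (a : Fin k → W) {E E' : Layer O W k X} (h : Iso E E') :
    PlanarIso (collapse a E) (collapse a E') := by
  by_cases hE : ∃ r, E = single r
  · obtain ⟨r, rfl⟩ := hE
    obtain ⟨r', rfl, h'⟩ := h.of_single
    rwa [collapse_single, collapse_single]
  · have hE' : ∀ r, E' ≠ single r := by
      rintro r rfl
      obtain ⟨r', rfl, -⟩ := h.symm.of_single
      exact hE ⟨r', rfl⟩
    rw [collapse_of_ne a (not_exists.mp hE), collapse_of_ne a hE']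
    exact h.planarIso a

theorem expand_of_not_isOp {r : LabeledTree O W k X} (h : ¬ r.IsOp) : expand r = single r := by
  cases r with
  | leaf x => rfl
  | op a m α c => exact absurd trivial h
  | inv a w c => rfl

/-- Only an identity layer is changed by `collapse`, and `expand` reinserts it because the remaining
tree does not start with a piece `1 → m`. Without the hypothesis, `expand` would return the root
piece of that tree instead. -/
theorem expand_collapse (a : Fin k → W) {E : Layer O W k X} (h : ∀ s, ¬ (E.c s).IsOp) :
    expand (collapse a E) = E := by
  by_cases hE : ∃ r, E = single r
  · obtain ⟨r, rfl⟩ := hE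
    rw [collapse_single]
    exact expand_of_not_isOp (h (0 : Fin 1))
  · rw [collapse_of_ne a (not_exists.mp hE)]
    rfl

theorem PlanarIso.expand {r r' : LabeledTree O W k X} (h : PlanarIso r r') :
    Iso (expand r) (expand r') := by
  induction h with
  | refl r => exact .refl _
  | trans _ _ ih ih' => exact ih.trans ih'
  | congrOp a m α c c' h _ => exact ⟨Equiv.refl _, fun _ => (O.actEquiv_refl _).symm, h⟩
  | congrInv a w c c' h _ => exact .single (.congrInv _ _ _ _ h)
  | permute a m α c σ => exact ⟨σ, fun _ => rfl, fun _ => .refl _⟩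

theorem collapseInv_one (a : Fin k → W) (r : LabeledTree O W k X) : collapseInv a 1 r = r :=
  if_pos rfl

theorem expandInv_of_not_isInv {r : LabeledTree O W k X} (h : ¬ r.IsInv) :
    expandInv r = (1, r) := by
  cases r with
  | leaf x => rfl
  | op a m α c => rfl
  | inv a w c => exact absurd trivial h

theorem expandInv_collapseInv (a : Fin k → W) (w : Fin (k + 1) → W) {r : LabeledTree O W k X}
    (h : ¬ r.IsInv) : expandInv (collapseInv a w r) = (w, r) := by
  by_cases hw : w = 1
  · subst hw
    rw [collapseInv_one, expandInv_of_not_isInv h]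
  · rw [collapseInv, if_neg hw]
    rfl

theorem collapseInv_planarIso (a : Fin k → W) (w : Fin (k + 1) → W) {r r' : LabeledTree O W k X}
    (h : PlanarIso r r') : PlanarIso (collapseInv a w r) (collapseInv a w r') := by
  unfold collapseInv
  split_ifs
  · exact h
  · exact .congrInv _ _ _ _ h

theorem PlanarIso.expandInv {r r' : LabeledTree O W k X} (h : PlanarIso r r') :
    (expandInv r).1 = (expandInv r').1 ∧ PlanarIso (expandInv r).2 (expandInv r').2 := by
  induction h with
  | refl r => exact ⟨rfl, .refl _⟩
  | trans _ _ ih ih' => exact ⟨ih.1.trans ih'.1, ih.2.trans ih'.2⟩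
  | congrOp a m α c c' h _ => exact ⟨rfl, .congrOp _ _ _ _ _ h⟩
  | congrInv a w c c' h _ => exact ⟨rfl, h⟩
  | permute a m α c σ => exact ⟨rfl, .permute _ _ _ _ _⟩

/-- Adjacent pieces point in different directions and there are no columns of identities. -/
def Reduced : LabeledTree O W k X → Prop
  | leaf _ => True
  | op _ m α c => (∀ s, ¬ (c s).IsOp) ∧ (∀ r, Layer.mk m α c ≠ single r) ∧ ∀ s, (c s).Reduced
  | inv _ w c => ¬ c.IsInv ∧ w ≠ 1 ∧ c.Reduced

theorem Reduced.expand {r : LabeledTree O W k X} (h : r.Reduced) (s : Fin (expand r).m) :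
    ¬ ((LabeledTree.expand r).c s).IsOp ∧ ((LabeledTree.expand r).c s).Reduced := by
  cases r with
  | leaf x => exact ⟨id, h⟩
  | op a m α c => exact ⟨h.1 s, h.2.2 s⟩
  | inv a w c => exact ⟨id, h⟩

theorem Reduced.expandInv {r : LabeledTree O W k X} (h : r.Reduced) :
    ¬ (expandInv r).2.IsInv ∧ (LabeledTree.expandInv r).2.Reduced := by
  cases r with
  | leaf x => exact ⟨id, h⟩
  | op a m α c => exact ⟨id, h⟩
  | inv a w c => exact ⟨h.1, h.2.2⟩

theorem reduced_collapse (a : Fin k → W) {E : Layer O W k X} (h : ∀ s, ¬ (E.c s).IsOp)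
    (h' : ∀ s, (E.c s).Reduced) : (collapse a E).Reduced := by
  by_cases hE : ∃ r, E = single r
  · obtain ⟨r, rfl⟩ := hE
    rw [collapse_single]
    exact h' (0 : Fin 1)
  · rw [collapse_of_ne a (not_exists.mp hE)]
    exact ⟨h, not_exists.mp hE, h'⟩

theorem reduced_collapseInv (a : Fin k → W) (w : Fin (k + 1) → W) {r : LabeledTree O W k X}
    (h : ¬ r.IsInv) (h' : r.Reduced) : (collapseInv a w r).Reduced := by
  unfold collapseInv
  split_ifs with hw
  · exact h'
  · exact ⟨h, hw, h'⟩

/-- The result of composing all adjacent columns which point in the same direction and deleting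
all columns of identities. -/
noncomputable def reduce : LabeledTree O W k X → LabeledTree O W k X
  | leaf x => leaf x
  | op a _ α c => collapse a (comp α (fun s => expand (c s).reduce))
  | inv a w c => collapseInv a ((expandInv c.reduce).1 * w) (expandInv c.reduce).2

/-- Below the root piece of a reduced tree there is no further piece `1 → m`, so a single round of
absorption suffices. -/
theorem comp_expand_reduced {m : ℕ} (α : Fin (k + 1) → O.Op m) {c : Fin m → LabeledTree O W k X}
    (h : ∀ s, (c s).Reduced) (z) : ¬ ((comp α (fun s => expand (c s))).c z).IsOp ∧
      ((comp α (fun s => expand (c s))).c z).Reduced :=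
  (h _).expand _

theorem reduced_reduce (r : LabeledTree O W k X) : r.reduce.Reduced := by
  induction r with
  | leaf x => trivial
  | op a m α c ih =>
    exact reduced_collapse a (fun z => (comp_expand_reduced α ih z).1)
      (fun z => (comp_expand_reduced α ih z).2)
  | inv a w c ih => exact reduced_collapseInv _ _ ih.expandInv.1 ih.expandInv.2

/-- On a reduced tree only identity columns are absorbed, and none is dropped. Absorbing identities
changes the arity from `m` to `∑ 1`; stating the result up to isomorphism avoids transport along
this equality. -/
theorem Reduced.reduce_planarIso {r : LabeledTree O W k X} (h : r.Reduced) :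
    PlanarIso r.reduce r := by
  induction r with
  | leaf x => exact .refl _
  | op a m α c ih =>
    have h₁ : Iso (comp α (fun s => LabeledTree.expand (c s).reduce)) ⟨m, α, c⟩ :=
      (Iso.comp α (fun s => expand_of_not_isOp (h.1 s) ▸ (ih s (h.2.2 s)).expand)).trans
        (comp_single_iso ⟨m, α, c⟩)
    refine (collapse_planarIso a h₁).trans ?_
    rw [collapse_of_ne a h.2.1]
    exact .refl _
  | inv a w c ih =>
    have h₁ := (ih h.2.2).expandInv
    rw [expandInv_of_not_isInv h.1] at h₁
    rw [reduce, h₁.1, one_mul]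
    refine (collapseInv_planarIso a w h₁.2).trans ?_
    rw [collapseInv, if_neg h.2.1]
    exact .refl _

end LabeledTree

/-! ### Normal forms of tree hammocks and invariance under equivalence -/

namespace Hammock

variable {O : SymmOperad.{u}} {W : Submonoid (O.Op 1)} {k : ℕ} {X : Type}

open LabeledTree (Layer expand collapse expandInv collapseInv reduce)

/-- The underlying labeled tree of a tree hammock. -/
def toTree : ∀ {a : Fin k → W}, Hammock O W k X a → LabeledTree O W k X
  | _, leaf _ _ x => .leaf x
  | _, op a m α _ _ c => .op a m α (fun s => (c s).toTree)
  | _, inv a _ w _ c => .inv a w c.toTree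

/-- By induction the subtrees determine the vertical arrows at the leaf nodes, a labeled leaf can
only have identities, and the squares are propositions. -/
theorem toTree_injective {a a' : Fin k → W} (t : Hammock O W k X a) (t' : Hammock O W k X a')
    (h : t.toTree = t'.toTree) : a = a' ∧ t ≍ t' := by
  induction t generalizing a' with
  | leaf a ha x =>
    cases t' with
    | leaf a' ha' x' =>
      subst ha; subst ha'
      cases h
      exact ⟨rfl, HEq.rfl⟩
    | op => cases h
    | inv => cases h
  | op a m α b sq c ih =>
    cases t' with
    | leaf => cases h
    | op a' m' α' b' sq' c' =>
      simp only [toTree, LabeledTree.op.injEq] at h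
      obtain ⟨rfl, rfl, h₁, h₂⟩ := h
      have h₃ := fun s => ih s (c' s) (congrFun (eq_of_heq h₂) s)
      exact ⟨rfl, heq_of_eq (op_congr (eq_of_heq h₁) (funext fun s => (h₃ s).1)
        (fun s => (h₃ s).2))⟩
    | inv => cases h
  | inv a b w sq c ih =>
    cases t' with
    | leaf => cases h
    | op => cases h
    | inv a' b' w' sq' c' =>
      simp only [toTree, LabeledTree.inv.injEq] at h
      obtain ⟨rfl, h₁, h₂⟩ := h
      have h₃ := ih c' h₂
      exact ⟨rfl, heq_of_eq (inv_congr h₁ h₃.1 h₃.2)⟩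

theorem isOp_toTree {a : Fin k → W} (t : Hammock O W k X a) : t.toTree.IsOp ↔ t.RootIsOp := by
  cases t <;> rfl

theorem isInv_toTree {a : Fin k → W} (t : Hammock O W k X a) : t.toTree.IsInv ↔ t.RootIsInv := by
  cases t <;> rfl

theorem reduced_toTree {a : Fin k → W} (t : Hammock O W k X a) :
    t.toTree.Reduced ↔ t.Reduced := by
  induction t with
  | leaf a ha x => rfl
  | op a m α b sq c ih =>
    simp only [toTree, LabeledTree.Reduced, Reduced, isOp_toTree, ih]
    refine and_congr_right fun _ => and_congr_left fun _ => ?_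
    rw [← not_exists]
    refine not_congr ⟨?_, ?_⟩
    · rintro ⟨r, hr⟩
      simp only [Layer.single, Layer.mk.injEq] at hr
      obtain ⟨rfl, hα, -⟩ := hr
      exact ⟨rfl, fun i => congrFun (eq_of_heq hα) i⟩
    · rintro ⟨rfl, hα⟩
      obtain rfl : α = fun _ => O.one := funext hα
      exact ⟨(c 0).toTree, congrArg (Layer.mk 1 _) (funext fun s => by
        rw [Subsingleton.elim s 0])⟩
  | inv a b w sq c ih =>
    simp only [toTree, LabeledTree.Reduced, Reduced, isInv_toTree, ih, ne_eq, funext_iff,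
      Pi.one_apply]

/-- The intermediate trees of a chain of planar changes are not known to come from hammocks. They
are lifted one after the other from the left end, which works because permuting preserves squares
(`OpSquares.act`). -/
theorem exists_planarIso_of_toTree {r r' : LabeledTree O W k X} (h : r.PlanarIso r')
    {a : Fin k → W} (t : Hammock O W k X a) (ht : t.toTree = r) :
    ∃ t' : Hammock O W k X a, t'.toTree = r' ∧ PlanarIso t t' := by
  induction h generalizing a with
  | refl r => exact ⟨t, ht, .refl t⟩
  | trans _ _ ih ih' =>
    obtain ⟨t', ht', h⟩ := ih t ht
    obtain ⟨t'', ht'', h'⟩ := ih' t' ht'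
    exact ⟨t'', ht'', h.trans h'⟩
  | congrOp a' m α c c' _ ih =>
    cases t with
    | leaf => cases ht
    | op a m' α' b sq d =>
      cases ht
      choose t' ht' h using fun s => ih s (d s) rfl
      exact ⟨op a' m α b sq t', congrArg _ (funext ht'), .congrOp _ _ _ _ _ _ _ h⟩
    | inv => cases ht
  | congrInv a' w c c' _ ih =>
    cases t with
    | leaf => cases ht
    | op => cases ht
    | inv a b w' sq d =>
      cases ht
      obtain ⟨t', ht', h⟩ := ih d rfl
      exact ⟨inv a' b w sq t', congrArg _ ht', .congrInv _ _ _ _ _ _ h⟩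
  | permute a' m α c σ =>
    cases t with
    | leaf => cases ht
    | op a m' α' b sq d =>
      cases ht
      exact ⟨_, rfl, .permute a' m α b sq d σ (sq.act σ)⟩
    | inv => cases ht

theorem planarIso_of_toTree {a : Fin k → W} {t t' : Hammock O W k X a}
    (h : t.toTree.PlanarIso t'.toTree) : PlanarIso t t' := by
  obtain ⟨t'', h', h''⟩ := exists_planarIso_of_toTree h t rfl
  rwa [eq_of_heq (toTree_injective t'' t' h').2] at h''

theorem exists_equivalent_expand {a : Fin k → W} (t : Hammock O W k X a) :
    ∃ (b : Fin (expand t.toTree).m → Fin k → W) (sq : OpSquares a (expand t.toTree).α b)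
      (c : ∀ s, Hammock O W k X (b s)), (∀ s, (c s).toTree = (expand t.toTree).c s) ∧
        Equivalent t (op a _ _ b sq c) := by
  cases t with
  | leaf a ha x => exact ⟨fun _ => a, .one a, fun _ => leaf a ha x, fun _ => rfl,
      (Equivalent.deleteOp a (.one a) _).symm⟩
  | op a m α b sq c => exact ⟨b, sq, c, fun _ => rfl, .refl _⟩
  | inv a b w sq c => exact ⟨fun _ => a, .one a, fun _ => inv a b w sq c, fun _ => rfl,
      (Equivalent.deleteOp a (.one a) _).symm⟩

theorem exists_equivalent_collapse (a : Fin k → W) (E : Layer O W k X) (b : Fin E.m → Fin k → W)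
    (sq : OpSquares a E.α b) (c : ∀ s, Hammock O W k X (b s)) (hc : ∀ s, (c s).toTree = E.c s) :
    ∃ t : Hammock O W k X a, t.toTree = collapse a E ∧ Equivalent (op a _ _ b sq c) t := by
  by_cases hE : ∃ r, E = Layer.single r
  · obtain ⟨r, rfl⟩ := hE
    -- With identities as labels, the squares read `b = a`, so the subtree has the root column
    -- required by `deleteOp`.
    have hb : b = fun _ : Fin 1 => a := by
      funext s i
      have h := sq i
      have e : (fun s => ((b s i : W) : O.Op 1)) = fun _ : Fin 1 => ((b s i : W) : O.Op 1) :=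
        funext fun s' => congrArg (fun s => ((b s i : W) : O.Op 1)) (Subsingleton.elim (α := Fin 1) s' s)
      refine Subtype.ext ?_
      refine (O.one_unaryComp (b s i : O.Op 1)).symm.trans
        (((congrArg (O.compUnary O.one) e).symm.trans h).trans (O.compUnary_one (a i : O.Op 1)))
    subst hb
    rw [LabeledTree.collapse_single]
    refine ⟨c (0 : Fin 1), hc (0 : Fin 1), ?_⟩
    have e : c = fun _ : Fin 1 => c (0 : Fin 1) :=
      funext fun s => congrArg c (Subsingleton.elim (α := Fin 1) s 0)
    rw [e]
    exact .deleteOp a sq (c (0 : Fin 1))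
  · rw [LabeledTree.collapse_of_ne a (not_exists.mp hE)]
    exact ⟨op a E.m E.α b sq c, congrArg _ (funext hc), .refl _⟩

theorem exists_equivalent_expandInv {a : Fin k → W} (t : Hammock O W k X a) :
    ∃ (b : Fin k → W) (sq : InvSquares a (expandInv t.toTree).1 b) (c : Hammock O W k X b),
      c.toTree = (expandInv t.toTree).2 ∧ Equivalent t (inv a _ _ sq c) := by
  cases t with
  | leaf a ha x => exact ⟨a, .one a, leaf a ha x, rfl, (Equivalent.deleteInv a (.one a) _).symm⟩
  | op a m α b sq c =>
    exact ⟨a, .one a, op a m α b sq c, rfl, (Equivalent.deleteInv a (.one a) _).symm⟩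
  | inv a b w sq c => exact ⟨b, sq, c, rfl, .refl _⟩

theorem exists_equivalent_collapseInv (a b : Fin k → W) (w : Fin (k + 1) → W)
    (sq : InvSquares a w b) (c : Hammock O W k X b) :
    ∃ t : Hammock O W k X a, t.toTree = collapseInv a w c.toTree ∧
      Equivalent (inv a b w sq c) t := by
  by_cases hw : w = 1
  · subst hw
    obtain rfl : a = b := by
      funext i
      simpa using sq i
    rw [LabeledTree.collapseInv_one]
    exact ⟨c, rfl, .deleteInv a sq c⟩
  · rw [collapseInv, if_neg hw]
    exact ⟨inv a b w sq c, rfl, .refl _⟩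

theorem exists_equivalent_reduce {a : Fin k → W} (t : Hammock O W k X a) :
    ∃ t' : Hammock O W k X a, t'.toTree = reduce t.toTree ∧ Equivalent t t' := by
  induction t with
  | leaf a ha x => exact ⟨leaf a ha x, rfl, .refl _⟩
  | op a m α b sq c ih =>
    choose c' hc' h using ih
    choose d sq' e he h' using fun s => exists_equivalent_expand (c' s)
    obtain ⟨t', ht', h''⟩ := exists_equivalent_collapse a
      (Layer.comp α (fun s => expand (c' s).toTree)) _ (sq.comp sq')
      (fun z => e (finSigmaFinEquiv.symm z).1 (finSigmaFinEquiv.symm z).2) (fun z => he _ _)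
    refine ⟨t', ?_, ?_⟩
    · simp only [hc'] at ht'
      exact ht'
    · refine Equivalent.trans ?_ h''
      -- After normalization, the inserted identity columns make every subtree start with a piece `1
      -- → m`, as `composeOp` requires.
      exact (Equivalent.congrOp a m α b sq _ _ (fun s => (h s).trans (h' s))).trans
        (.composeOp a m α b sq _ _ d sq' e (sq.comp sq'))
  | inv a b w sq c ih =>
    obtain ⟨c', hc', h⟩ := ih
    obtain ⟨b', sq', d, hd, h'⟩ := exists_equivalent_expandInv c'
    obtain ⟨t', ht', h''⟩ := exists_equivalent_collapseInv a b' _ (sq.mul sq') d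
    refine ⟨t', ?_, ?_⟩
    · rw [ht', hd, hc']
      rfl
    · refine Equivalent.trans ?_ h''
      exact (Equivalent.congrInv a b w sq _ _ (h.trans h')).trans
        (.composeInv a b b' w _ sq sq' d (sq.mul sq'))

/-- In a general labeled tree, deleting an identity at the root may expose a piece with a different
root column. A hammock with root column `a` keeps this column in its normal form, so `collapse a`
restores the piece. -/
theorem collapse_expand_reduce {a : Fin k → W} (t : Hammock O W k X a) :
    collapse a (expand (reduce t.toTree)) = reduce t.toTree := by
  have hr := LabeledTree.reduced_reduce t.toTree
  obtain ⟨t', ht', -⟩ := exists_equivalent_reduce t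
  rw [← ht'] at hr ⊢
  cases t' with
  | leaf => exact LabeledTree.collapse_single _ _
  | op a m α b sq c => exact LabeledTree.collapse_of_ne a hr.2.1
  | inv => exact LabeledTree.collapse_single _ _

theorem collapseInv_expandInv_reduce {a : Fin k → W} (t : Hammock O W k X a) :
    collapseInv a (expandInv (reduce t.toTree)).1 (expandInv (reduce t.toTree)).2 =
      reduce t.toTree := by
  have hr := LabeledTree.reduced_reduce t.toTree
  obtain ⟨t', ht', -⟩ := exists_equivalent_reduce t
  rw [← ht'] at hr ⊢
  cases t' with
  | leaf => exact LabeledTree.collapseInv_one _ _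
  | op => exact LabeledTree.collapseInv_one _ _
  | inv => exact if_neg hr.2.1

/-- Each move corresponds to a law for layers: `permute` to equivariance, `composeOp` to
associativity, `deleteOp` to the left unit law. For pieces `1 ← 1` these are associativity and unit
of the monoid of columns in `W`. -/
theorem Equivalent.reduce_planarIso {a : Fin k → W} {t t' : Hammock O W k X a}
    (h : Equivalent t t') : (reduce t.toTree).PlanarIso (reduce t'.toTree) := by
  induction h with
  | refl t => exact .refl _
  | symm _ ih => exact ih.symm
  | trans _ _ ih ih' => exact ih.trans ih'
  | congrOp a m α b sq c c' _ ih =>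
    exact LabeledTree.collapse_planarIso a (Layer.Iso.comp α (fun s => (ih s).expand))
  | congrInv a b w sq c c' _ ih =>
    have h := ih.expandInv
    simp only [toTree, reduce, h.1]
    exact LabeledTree.collapseInv_planarIso a _ h.2
  | permute a m α b sq c σ sq' =>
    exact LabeledTree.collapse_planarIso a (Layer.comp_act_iso α _ σ)
  | composeOp a m α b sq j β d sq' c sq'' =>
    refine LabeledTree.collapse_planarIso a ?_
    -- `E` is the lower row of pieces, and `F` consists of the expanded normal forms of the trees
    -- below it. The composite piece absorbs `F` into `α ∘ E`; the uncomposed tree first absorbs `F`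
    -- into `E`.
    let E : Fin m → Layer O W k X := fun s => ⟨j s, β s, fun t => (c s t).toTree⟩
    let F : Fin (Layer.comp α E).m → Layer O W k X :=
      fun z => expand (reduce ((Layer.comp α E).c z))
    have hF : ∀ s t, F (finSigmaFinEquiv ⟨s, t⟩) = expand (reduce (c s t).toTree) :=
      fun s t => congrArg (fun r => expand (reduce r)) (Layer.comp_c α E ⟨s, t⟩)
    refine Layer.Iso.symm ((Layer.comp_comp_iso α E F).trans (Layer.Iso.comp α fun s => ?_))
    simp only [hF]
    -- Collapsing the lower layer in between is harmless, as the subtrees left below it do not start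
    -- with pieces `1 → m`.
    rw [toTree, reduce, LabeledTree.expand_collapse]
    · exact .refl _
    · exact fun z => (LabeledTree.comp_expand_reduced (β s)
        (fun t => LabeledTree.reduced_reduce (c s t).toTree) z).1
  | composeInv a b b' w w' sq sq' c sq'' =>
    simp only [toTree, reduce]
    rw [LabeledTree.expandInv_collapseInv _ _ (LabeledTree.reduced_reduce c.toTree).expandInv.1,
      mul_assoc]
    exact .refl _
  | deleteOp a sq c =>
    refine (LabeledTree.collapse_planarIso a (Layer.one_comp_iso _)).trans ?_
    rw [collapse_expand_reduce]
    exact .refl _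
  | deleteInv a sq c =>
    have h := collapseInv_expandInv_reduce c
    have e : (expandInv (reduce c.toTree)).1 * (fun _ => 1) = (expandInv (reduce c.toTree)).1 :=
      mul_one _
    simp only [toTree, reduce, e, h]
    exact .refl _

theorem PlanarIso.equivalent {a : Fin k → W} {t t' : Hammock O W k X a} (h : PlanarIso t t') :
    Equivalent t t' := by
  induction h with
  | refl t => exact .refl t
  | symm _ ih => exact ih.symm
  | trans _ _ ih ih' => exact ih.trans ih'
  | congrOp a m α b sq c c' _ ih => exact .congrOp _ _ _ _ _ _ _ ih
  | congrInv a b w sq c c' _ ih => exact .congrInv _ _ _ _ _ _ ih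
  | permute a m α b sq c σ sq' => exact .permute a m α b sq c σ sq'

theorem Reduced.equivalent_iff {a : Fin k → W} {t t' : Hammock O W k X a} (h : t.Reduced)
    (h' : t'.Reduced) : Equivalent t t' ↔ PlanarIso t t' := by
  refine ⟨fun e => planarIso_of_toTree ?_, PlanarIso.equivalent⟩
  exact (((reduced_toTree t).mpr h).reduce_planarIso.symm.trans e.reduce_planarIso).trans
    ((reduced_toTree t').mpr h').reduce_planarIso

theorem exists_reduced_equivalent {a : Fin k → W} (t : Hammock O W k X a) :
    ∃ t' : Hammock O W k X a, t'.Reduced ∧ Equivalent t t' := by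
  obtain ⟨t', ht', h⟩ := exists_equivalent_reduce t
  exact ⟨t', (reduced_toTree t').mp (ht' ▸ LabeledTree.reduced_reduce _), h⟩

/-- Ensures that the reduced representative again has bijectively labeled leaves. -/
theorem Equivalent.labels_eq {a : Fin k → W} {t t' : Hammock O W k X a} (h : Equivalent t t') :
    t.labels = t'.labels := by
  induction h with
  | refl t => rfl
  | symm _ ih => exact ih.symm
  | trans _ _ ih ih' => exact ih.trans ih'
  | congrOp a m α b sq c c' _ ih => simp only [labels, ih]
  | congrInv a b w sq c c' _ ih => exact ih
  | permute a m α b sq c σ sq' => exact (Equiv.sum_comp σ (fun s => (c s).labels)).symm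
  | composeOp a m α b sq j β d sq' c sq'' =>
    simp only [labels]
    rw [Equiv.sum_comp finSigmaFinEquiv.symm (fun p : Σ s, Fin (j s) => (c p.1 p.2).labels),
      Fintype.sum_sigma]
  | composeInv a b b' w w' sq sq' c sq'' => rfl
  | deleteOp a sq c => simp [labels]
  | deleteInv a sq c => rfl

end Hammock

/-! ### Isomorphisms of operads and the case of a trivial sub-monoid -/

theorem SymmOperad.isIso_of_bijective {O P : SymmOperad.{u}} (f : O ⟶ P)
    (h : ∀ n, Function.Bijective (f.app : O.Op n → P.Op n)) : IsIso f := by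
  let e : ∀ n, O.Op n ≃ P.Op n := fun n => Equiv.ofBijective _ (h n)
  have he : ∀ n (x : P.Op n), f.app ((e n).symm x) = x := fun n => (e n).apply_symm_apply
  have he' : ∀ n (x : O.Op n), (e n).symm (f.app x) = x := fun n => (e n).symm_apply_apply
  let g : P ⟶ O :=
    { app := fun {n} x => (e n).symm x
      map_one := (h 1).1 (by rw [he, f.map_one])
      map_act := fun x σ => (h _).1 (by rw [he, f.map_act, he])
      map_comp := fun x y => (h _).1 (by rw [he, f.map_comp, he]; simp only [he]) }
  exact ⟨g, SymmOperad.hom_ext he', SymmOperad.hom_ext he⟩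

theorem LabeledTree.PlanarIso.leaf_eq {O : SymmOperad.{u}} {W : Submonoid (O.Op 1)} {k : ℕ}
    {X : Type} {x : X} {r : LabeledTree O W k X} (h : PlanarIso (leaf x) r) : r = leaf x := by
  generalize hr : leaf x = r' at h
  induction h with
  | refl r => rfl
  | trans _ _ ih ih' => exact (ih' (hr.trans (ih hr).symm)).trans (ih hr)
  | _ => cases hr

theorem OpSquares.const {O : SymmOperad.{u}} {W : Submonoid (O.Op 1)} {k n : ℕ} (x : O.Op n) :
    OpSquares (1 : Fin k → W) (fun _ => x) (fun _ => 1) :=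
  fun _ => (O.compUnary_one x).trans (O.one_unaryComp x).symm

/-- With only identities as vertical arrows, the squares equate the labels in consecutive planes. -/
theorem OpSquares.eq_const {O : SymmOperad.{u}} {k m : ℕ} {a : Fin k → (⊥ : Submonoid (O.Op 1))}
    {α : Fin (k + 1) → O.Op m} {b : Fin m → Fin k → (⊥ : Submonoid (O.Op 1))}
    (sq : OpSquares a α b) : α = fun _ => α 0 := by
  have ha : ∀ x : (⊥ : Submonoid (O.Op 1)), (x : O.Op 1) = O.one := fun x =>
    Submonoid.mem_bot.mp x.2
  funext i
  induction i using Fin.induction with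
  | zero => rfl
  | succ i ih =>
    have h := sq i
    simp only [ha] at h
    rw [O.compUnary_one, O.one_unaryComp] at h
    rw [← h, ih]

theorem Submonoid.subsingleton_bot {M : Type u} [Monoid M] :
    Subsingleton (⊥ : Submonoid M) :=
  ⟨fun x y => Subtype.ext ((Submonoid.mem_bot.mp x.2).trans (Submonoid.mem_bot.mp y.2).symm)⟩

/-- A column of pieces `1 ← 1` with labels in the trivial monoid consists of identities, which a
reduced hammock excludes. -/
theorem Hammock.exists_eq_leaf {O : SymmOperad.{u}} {k : ℕ} {X : Type}
    {a : Fin k → (⊥ : Submonoid (O.Op 1))} (t : Hammock O ⊥ k X a) (h : t.Reduced)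
    (h' : ¬ t.RootIsOp) : ∃ (ha : a = 1) (x : X), t = leaf a ha x := by
  have := Submonoid.subsingleton_bot (M := O.Op 1)
  cases t with
  | leaf a ha x => exact ⟨ha, x, rfl⟩
  | op => exact absurd trivial h'
  | inv a b w sq c => exact absurd (fun i => Subsingleton.elim _ _) h.2.1

theorem Hammock.leaf_heq {O : SymmOperad.{u}} {W : Submonoid (O.Op 1)} {k : ℕ} {X : Type}
    {a a' : Fin k → W} (ha : a = 1) (ha' : a' = 1) (x : X) :
    (leaf a ha x : Hammock O W k X a) ≍ (leaf a' ha' x : Hammock O W k X a') := by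
  subst ha; subst ha'; rfl

/-! ### Reduced representatives and corollas -/

namespace TreeHammock

section

variable {O P : SymmOperad.{u}} {W : Submonoid (O.Op 1)} {V : Submonoid (P.Op 1)} {k l n : ℕ}

theorem cls_eq_cls_iff {t t' : TreeHammock O W k n} :
    cls t = cls t' ↔ Hammock.Equivalent t.1 t'.1 :=
  Quotient.eq

theorem exists_reduced_cls (z : Class O W k n) :
    ∃ t : TreeHammock O W k n, t.1.Reduced ∧ cls t = z := by
  induction z using Class.ind with | _ t =>
  obtain ⟨t', hr, h⟩ := Hammock.exists_reduced_equivalent t.1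
  exact ⟨⟨t', h.labels_eq ▸ t.2⟩, hr, cls_eq_cls_iff.mpr h.symm⟩

theorem map_corolla (φ : O ⟶ P) (hφ : ∀ w ∈ W, φ.app w ∈ V) (x : O.Op n) :
    TreeHammock.map φ hφ (corolla W k x) = corolla V k (φ.app x) :=
  Subtype.ext (Hammock.op_congr rfl (funext fun _ => (Hammock.one_eq_map_one φ hφ).symm)
    (fun s => Hammock.leaf_heq _ _ s))

theorem reindex_corolla (θ : Fin (l + 1) →o Fin (k + 1)) (x : O.Op n) :
    TreeHammock.reindex θ (corolla W k x) = corolla W l x :=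
  Subtype.ext (Hammock.op_congr rfl (funext fun _ => reindexVert_one θ)
    (fun s => Hammock.leaf_heq _ _ s))

/-- The label is recovered from the normal form, for an arbitrary `W`: the distinct leaf labels
rigidify the corolla. -/
theorem cls_corolla_injective (x y : O.Op n) (h : cls (corolla W k x) = cls (corolla W k y)) :
    x = y := by
  have h₁ := (cls_eq_cls_iff.mp h).reduce_planarIso.expand
  -- Reduction turns a corolla labeled by the unit into a trivial tree; expanding afterwards treats
  -- this case uniformly with the others.
  have key : ∀ z : O.Op n, LabeledTree.Layer.Iso
      (LabeledTree.expand (LabeledTree.reduce (corolla W k z).1.toTree))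
      ⟨n, fun _ => z, fun s => LabeledTree.leaf s⟩ := by
    intro z
    have e : LabeledTree.expand (LabeledTree.reduce (corolla W k z).1.toTree) =
        LabeledTree.Layer.comp (fun _ => z)
          (fun s : Fin n => LabeledTree.Layer.single (LabeledTree.leaf s)) :=
      LabeledTree.expand_collapse (1 : Fin k → W) (fun _ => id)
    rw [e]
    exact LabeledTree.Layer.comp_single_iso ⟨n, fun _ => z, fun s => LabeledTree.leaf s⟩
  obtain ⟨e, he, he'⟩ := ((key x).symm.trans h₁).trans (key y)
  -- A leaf is planar isomorphic only to itself, so the bijection preserves the leaf labels.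
  obtain rfl : e = Equiv.refl _ := by
    ext s
    have := (he' s).leaf_eq
    simp only [LabeledTree.leaf.injEq] at this
    exact congrArg Fin.val this.symm
  exact ((he 0).trans (O.actEquiv_refl x)).symm

/-- The map of operads which sends an operation to the class of the corolla labeled by it. -/
noncomputable def corollaHom (W : Submonoid (O.Op 1)) (k : ℕ) : O ⟶ hammockOperad O W k where
  app x := cls (corolla W k x)
  map_one := by
    refine cls_eq_cls_iff.mpr ?_
    refine Hammock.Equivalent.trans (.of_eq ?_)
      (.deleteOp 1 (.one 1) (Hammock.leaf 1 rfl (0 : Fin 1)))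
    exact Hammock.op_congr rfl rfl (fun s => by rw [Subsingleton.elim s 0])
  map_act {n} x σ := by
    refine cls_eq_cls_iff.mpr (Hammock.Equivalent.symm ?_)
    -- The action of `σ` relabels leaves by `σ.symm`; permuting the branches by `σ` then puts the
    -- leaf labels back in order.
    refine (Hammock.Equivalent.permute 1 n (fun _ => x) (fun _ => 1) _
      (fun s => Hammock.leaf 1 rfl (σ.symm s)) σ (.const _)).trans
      (.of_eq ?_)
    exact Hammock.op_congr rfl rfl (fun s => heq_of_eq (congrArg (Hammock.leaf 1 rfl) (σ.symm_apply_apply s)))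
  map_comp {m j} x y := by
    refine Eq.trans ?_ (Class.comp_cls (corolla W k x) (fun s => corolla W k (y s))).symm
    refine cls_eq_cls_iff.mpr (Hammock.Equivalent.symm ?_)
    refine (Hammock.Equivalent.composeOp 1 m (fun _ => x) (fun _ => 1) (.const x) j
      (fun s _ => y s) (fun _ _ => 1) (fun s => .const (y s))
      (fun s t => Hammock.leaf 1 rfl (finSigmaFinEquiv ⟨s, t⟩)) (.const _)).trans (.of_eq ?_)
    exact Hammock.op_congr rfl rfl (fun z => heq_of_eq
      (congrArg (Hammock.leaf 1 rfl) (finSigmaFinEquiv.apply_symm_apply z)))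

theorem cls_corolla_surjective (z : Class O ⊥ k n) : ∃ x, cls (corolla ⊥ k x) = z := by
  obtain ⟨⟨t, ht⟩, hr, rfl⟩ := exists_reduced_cls z
  have := Submonoid.subsingleton_bot (M := O.Op 1)
  cases t with
  | leaf _ ha x =>
    obtain rfl : n = 1 := by simpa [Hammock.labels] using (congrArg Multiset.card ht).symm
    obtain rfl : x = 0 := Subsingleton.elim _ _
    exact ⟨O.one, (corollaHom ⊥ k).map_one⟩
  | op _ m α b sq c =>
    choose hb x hx using fun s => (c s).exists_eq_leaf (hr.2.2 s) (hr.1 s)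
    obtain rfl : b = fun _ => 1 := funext hb
    obtain rfl : c = fun s => Hammock.leaf 1 rfl (x s) := funext hx
    have h₁ : (Finset.univ : Finset (Fin m)).val.map x = (Finset.univ : Finset (Fin n)).val := by
      rw [← ht, ← Multiset.sum_map_singleton (Multiset.map x _), Multiset.map_map]
      rfl
    obtain rfl : m = n := by simpa using congrArg Multiset.card h₁
    have hx' : Function.Surjective x := by
      intro y
      have hy : y ∈ (Finset.univ : Finset (Fin m)).val.map x := by
        rw [h₁]
        exact Finset.mem_univ y
      obtain ⟨s, -, hs⟩ := Multiset.mem_map.mp hy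
      exact ⟨s, hs⟩
    -- The leaf labels form a permutation. Acting with `σ.symm` on the standard corolla relabels its
    -- leaves by `σ`, which reproduces the given hammock.
    let σ : Equiv.Perm (Fin m) := Equiv.ofBijective x (Finite.surjective_iff_bijective.mp hx')
    refine ⟨O.act (α 0) σ.symm, ((corollaHom ⊥ k).map_act (α 0) σ.symm).trans ?_⟩
    exact cls_eq (Hammock.op_congr sq.eq_const.symm rfl (fun s => HEq.rfl))
  | inv _ b w sq c => exact absurd (fun i => Subsingleton.elim _ _) hr.2.1

end

end TreeHammock

/-! ### Functoriality and the natural map from the operad -/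

namespace SimplicialPair

/-- The map of localizations induced by a map of pairs. -/
noncomputable def mapLocalization {P Q : SimplicialPair.{u}} (φ : P ⟶ Q) :
    P.treeHammockLocalization ⟶ Q.treeHammockLocalization where
  app x := hammockOperad.map (φ.operadMap.app (.op x.unop.1)) (φ.mem _) x.unop.2.len
  naturality x y f := by
    -- Both ways around the naturality square apply the same map of operads to all labels before
    -- reindexing the planes.
    have hmem : ∀ w ∈ P.W (.op x.unop.1), (P.operad.map f.unop.1.op ≫
        φ.operadMap.app (.op y.unop.1)).app w ∈ Q.W (.op y.unop.1) :=
      fun w hw => φ.mem _ _ (P.map_mem f.unop.1.op w hw)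
    have h₁ := hammockOperad.map_comp_eq (k := x.unop.2.len) (P.operad.map f.unop.1.op)
      (P.map_mem f.unop.1.op) (φ.operadMap.app (.op y.unop.1)) (φ.mem _) _ hmem rfl
    have h₂ := hammockOperad.map_comp_eq (k := x.unop.2.len) (φ.operadMap.app (.op x.unop.1))
      (φ.mem _) (Q.operad.map f.unop.1.op) (Q.map_mem f.unop.1.op) _ hmem
      (φ.operadMap.naturality f.unop.1.op)
    have h₃ := hammockOperad.reindex_map (φ.operadMap.app (.op y.unop.1)) (φ.mem _)
      f.unop.2.toOrderHom
    dsimp only [treeHammockLocalization]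
    rw [Category.assoc, h₃, ← Category.assoc, h₁, ← h₂, Category.assoc]

/-- Every simplex is the class of a hammock; this gives the uniqueness of the induced map. -/
theorem hom_ext_cls {P : SimplicialPair.{u}} {B : BisimplicialOperad.{u}}
    {Φ Ψ : P.treeHammockLocalization ⟶ B}
    (h : ∀ (x : (SimplexCategory × SimplexCategory)ᵒᵖ) (n : ℕ) (t : P.Hammocks x n),
      (Φ.app x).app (P.cls t) = (Ψ.app x).app (P.cls t)) : Φ = Ψ := by
  refine NatTrans.ext (funext fun x => SymmOperad.hom_ext fun n z => ?_)
  induction z using TreeHammock.Class.ind with | _ t =>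
  exact h x n t

theorem mapLocalization_id (P : SimplicialPair.{u}) :
    mapLocalization (𝟙 P) = 𝟙 P.treeHammockLocalization :=
  NatTrans.ext (funext fun _ => hammockOperad.map_eq_id _ _ rfl)

theorem mapLocalization_comp {P Q R : SimplicialPair.{u}} (φ : P ⟶ Q) (ψ : Q ⟶ R) :
    mapLocalization (φ ≫ ψ) = mapLocalization φ ≫ mapLocalization ψ :=
  NatTrans.ext (funext fun _ => (hammockOperad.map_comp_eq _ _ _ _ _ _ rfl).symm)

/-- The map from a simplicial operad to its localization. -/
noncomputable def toLocalization (P : SimplicialPair.{u}) :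
    const.obj P.operad ⟶ P.treeHammockLocalization where
  app x := TreeHammock.corollaHom (P.W (.op x.unop.1)) x.unop.2.len
  naturality x y f := by
    refine SymmOperad.hom_ext fun n α => ?_
    have h₁ := TreeHammock.map_corolla (k := x.unop.2.len) (P.operad.map f.unop.1.op)
      (P.map_mem f.unop.1.op) (n := n) α
    have h₂ := TreeHammock.reindex_corolla (W := P.W (.op y.unop.1)) f.unop.2.toOrderHom
      ((P.operad.map f.unop.1.op).app (n := n) α)
    exact (congrArg TreeHammock.cls ((congrArg (TreeHammock.reindex _) h₁).trans h₂)).symm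

theorem toLocalization_app {P : SimplicialPair.{u}}
    (x : (SimplexCategory × SimplexCategory)ᵒᵖ) (n : ℕ)
    (α : ((const.obj P.operad).obj x).Op n) :
    ((toLocalization P).app x).app α = P.cls (P.corolla α) := rfl

theorem toLocalization_mapLocalization {P Q : SimplicialPair.{u}} (φ : P ⟶ Q) :
    toLocalization P ≫ mapLocalization φ = const.map φ.operadMap ≫ toLocalization Q := by
  refine NatTrans.ext (funext fun x => SymmOperad.hom_ext fun n α => ?_)
  exact congrArg TreeHammock.cls (TreeHammock.map_corolla (φ.operadMap.app (.op x.unop.1))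
    (φ.mem _) (n := n) α)

theorem isIso_toLocalization_trivial (O : SimplicialOperad.{u}) :
    IsIso (toLocalization (trivial O)) := by
  have : ∀ x, IsIso ((toLocalization (trivial O)).app x) := fun x =>
    SymmOperad.isIso_of_bijective _ fun n =>
      ⟨fun α β h => TreeHammock.cls_corolla_injective α β h,
        fun z => TreeHammock.cls_corolla_surjective z⟩
  exact NatIso.isIso_of_isIso_app _

end SimplicialPair

theorem mainTheorem3 :
    -- every operation of the localization is represented by a reduced tree hammock, which is
    -- unique up to changes of the planar structure
    (∀ (P : SimplicialPair.{u}) (x : (SimplexCategory × SimplexCategory)ᵒᵖ) (n : ℕ),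
      (∀ z : (P.treeHammockLocalization.obj x).Op n,
        ∃ t : P.Hammocks x n, t.1.Reduced ∧ P.cls t = z) ∧
      (∀ t t' : P.Hammocks x n, t.1.Reduced → t'.1.Reduced →
        (P.cls t = P.cls t' ↔ Hammock.PlanarIso t.1 t'.1))) ∧
    -- maps of pairs induce maps of localizations, by applying them to all labels
    ∃ L : ∀ {P Q : SimplicialPair.{u}}, (P ⟶ Q) →
        (P.treeHammockLocalization ⟶ Q.treeHammockLocalization),
      (∀ {P Q : SimplicialPair.{u}} (φ : P ⟶ Q)
        (Φ : P.treeHammockLocalization ⟶ Q.treeHammockLocalization),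
        Φ = L φ ↔ ∀ (x : (SimplexCategory × SimplexCategory)ᵒᵖ) (n : ℕ) (t : P.Hammocks x n),
          (Φ.app x).app (P.cls t) = Q.cls (SimplicialPair.mapHammock φ t)) ∧
      (∀ P : SimplicialPair.{u}, L (𝟙 P) = 𝟙 P.treeHammockLocalization) ∧
      (∀ {P Q R : SimplicialPair.{u}} (φ : P ⟶ Q) (ψ : Q ⟶ R), L (φ ≫ ψ) = L φ ≫ L ψ) ∧
      -- the natural map from the operad to its localization
      ∃ η : ∀ P : SimplicialPair.{u},
          SimplicialPair.const.obj P.operad ⟶ P.treeHammockLocalization,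
        (∀ (P : SimplicialPair.{u}) (x : (SimplexCategory × SimplexCategory)ᵒᵖ) (n : ℕ)
          (α : ((SimplicialPair.const.obj P.operad).obj x).Op n),
          ((η P).app x).app α = P.cls (P.corolla α)) ∧
        (∀ {P Q : SimplicialPair.{u}} (φ : P ⟶ Q),
          η P ≫ L φ = SimplicialPair.const.map φ.operadMap ≫ η Q) ∧
        (∀ O : SimplicialOperad.{u}, IsIso (η (SimplicialPair.trivial O))) ∧
        (∀ P : SimplicialPair.{u},
          η P = η (SimplicialPair.trivial P.operad) ≫ L P.fromTrivial) := by
  refine ⟨fun P x n => ⟨TreeHammock.exists_reduced_cls, fun t t' h h' =>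
    TreeHammock.cls_eq_cls_iff.trans (h.equivalent_iff h')⟩,
    SimplicialPair.mapLocalization, fun φ Φ => ⟨?_, fun h => SimplicialPair.hom_ext_cls h⟩,
    SimplicialPair.mapLocalization_id, SimplicialPair.mapLocalization_comp,
    SimplicialPair.toLocalization, fun _ => SimplicialPair.toLocalization_app,
    SimplicialPair.toLocalization_mapLocalization, SimplicialPair.isIso_toLocalization_trivial,
    fun P => ?_⟩
  · rintro rfl x n t
    rfl
  -- This is naturality of `η` for `fromTrivial`, whose underlying map of operads is the identity.
  · refine Eq.trans ?_ (SimplicialPair.toLocalization_mapLocalization P.fromTrivial).symm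
    rfl
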